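/- Let $C$ be a set (finite or infinite) with at least $4$ elements, the possible alternatives. A \emph{profile} $P$ consists of a non-empty finite set $A\subseteq C$ of alternatives and finitely many voters $i\in N$, $|N|=n$, each with a weak order (complete transitive relation) $\succcurlyeq_i$ on $A$; $\succ_i$ and $\sim_i$ denote strict preference and indifference. For $\emptyset\ne B\subseteq A$ let $P|_B$ be the profile with all weak orders restricted to $B$. A \emph{voting rule} $f$ assigns to every profile $P$ a non-empty set $f(P)\subseteq A$. A weak order with indifference classes $C_1\succ\dots\succ C_k$ has \emph{order type} $\tau=(|C_1|,\dots,|C_k|)$, and $|\tau|=k$. A \emph{monotone scoring system} $s$ assigns to every order type $\tau$ (non-empty finite list of positive integers) a vector $s(\tau)\in\mathbb{R}_{\ge0}^{|\tau|}$ with $s(\tau)_1\ge s(\tau)_2\ge\dots\ge s(\tau)_{|\tau|}=0$. The score $S_{P,s}(c)$ of $c\in A$ is the sum over the voters $i$ of $s(\tau_i)_{j}$, where $\tau_i$ is the order type of $\succcurlyeq_i$ and $c$ lies in its $j$-th indifference class. The \emph{elimination scoring rule} $f_s$ is defined recursively: $f_s(P)=A$ if $|A|=1$, and if $|A|\ge2$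 then $f_s(P)=\bigcup_{c\in L}f_s(P|_{A\setminus\{c\}})$, where $L$ is the set of alternatives $c\in A$ that minimize $S_{P,s}(c)$ (parallel-universe tie-breaking). A voting rule is an elimination scoring rule if it equals $f_s$ for some monotone scoring system $s$. \emph{Approval-IRV} is $f_s$ for $s(\tau)=(1,0,\dots,0)$ if $|\tau|\ge2$ and $s(\tau)=(0)$ if $|\tau|=1$. A non-empty set $X\subseteq A$ is a \emph{clone set} of $P$ if for every voter $i$ and every $c\in A\setminus X$, either $x\succ_i c$ for all $x\in X$, or $x\sim_i c$ for all $x\in X$, or $c\succ_i x$ for all $x\in X$. The rule $f$ satisfies \emph{independence of clones} if for every profile $P$, every clone set $X$ of $P$ and every $\hat x\in X$, with $\hat P=P|_{(A\setminus X)\cup\{\hat x\}}$: (1) for every $c\in A\setminus X$, $c\in f(P)$ if and only if $c\in f(\hat P)$; and (2) $\hat x\in f(\hat P)$ if and only if $x\in f(P)$ for some $x\in X$. The rule $f$ \emph{respects cohesive majorities} if for every profile $P$ and every set $S\subseteq N$ of voters with $|S|>n/2$ and $\bigcap_{i\in S}\mathrm{top}_i\neq\emptyset$, we have $f(P)\subseteq\bigcup_{i\in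 S}\mathrm{top}_i$, where $\mathrm{top}_i=\{c\in A: c\succcurlyeq_i d\text{ for all }d\in A\}$. \textbf{Theorem.} A voting rule $f$ is an elimination scoring rule that satisfies independence of clones and respects cohesive majorities if and only if $f$ is Approval-IRV. -/

import Mathlib

open scoped Finset

namespace Voting

universe u

/-- A weak order on the finite set `A`: a complete and transitive relation on `A`.
`rel a b` means that `a` is weakly preferred to `b`. The relation is a subset of `A × A`. -/
structure WeakOrder {C : Type u} (A : Finset C) where
  rel : C → C → Prop
  mem_of_rel : ∀ a b, rel a b → a ∈ A ∧ b ∈ A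
  complete : ∀ a ∈ A, ∀ b ∈ A, rel a b ∨ rel b a
  transitive : ∀ a b c, rel a b → rel b c → rel a c

namespace WeakOrder

variable {C : Type u} {A : Finset C}

/-- Strict preference. -/
def Pref (R : WeakOrder A) (a b : C) : Prop := R.rel a b ∧ ¬ R.rel b a

/-- Indifference. -/
def Indiff (R : WeakOrder A) (a b : C) : Prop := R.rel a b ∧ R.rel b a

open Classical in
/-- The indifference class of `a`. -/
noncomputable def indiffClass (R : WeakOrder A) (a : C) : Finset C := {b ∈ A | R.Indiff a b}

open Classical in
/-- The number of indifference classes that are strictly above `c`. So the indifference classes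
`C_1 ≻ … ≻ C_k` of the weak order are such that `c ∈ C_j` exactly if `rank c = j - 1`. -/
noncomputable def rank (R : WeakOrder A) (c : C) : ℕ := #({a ∈ A | R.Pref a c}.image R.indiffClass)

open Classical in
/-- The order type `(|C_1|, …, |C_k|)` of a weak order with indifference classes
`C_1 ≻ … ≻ C_k`. -/
noncomputable def orderType (R : WeakOrder A) : List ℕ :=
  List.ofFn fun j : Fin #(A.image R.indiffClass) => #{c ∈ A | R.rank c = j}

/-- The restriction of a weak order to a subset. -/
def restrict (R : WeakOrder A) (B : Finset C) (hB : B ⊆ A) : WeakOrder B where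
  rel a b := R.rel a b ∧ a ∈ B ∧ b ∈ B
  mem_of_rel _ _ h := h.2
  complete a ha b hb :=
    (R.complete a (hB ha) b (hB hb)).imp (fun h => ⟨h, ha, hb⟩) (fun h => ⟨h, hb, ha⟩)
  transitive a b c h h' := ⟨R.transitive a b c h.1 h'.1, h.2.1, h'.2.2⟩

end WeakOrder

/-- A profile: finitely many voters `0, …, n - 1`, each with a weak order over a common
non-empty finite set `cands` of alternatives. -/
structure Profile (C : Type u) where
  cands : Finset C
  cands_nonempty : cands.Nonempty
  n : ℕ
  ballot : Fin n → WeakOrder cands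

namespace Profile

variable {C : Type u}

/-- The profile obtained by restricting all weak orders to the set `B` of alternatives. -/
def restrict (P : Profile C) (B : Finset C) (hB : B ⊆ P.cands) (hne : B.Nonempty) : Profile C where
  cands := B
  cands_nonempty := hne
  n := P.n
  ballot i := (P.ballot i).restrict B hB

/-- The top alternatives of voter `i`. -/
def top (P : Profile C) (i : Fin P.n) : Set C :=
  {c | c ∈ P.cands ∧ ∀ d ∈ P.cands, (P.ballot i).rel c d}

/-- `X` is a (non-empty) clone set. -/
def IsCloneSet (P : Profile C) (X : Finset C) : Prop :=
  X.Nonempty ∧ X ⊆ P.cands ∧ ∀ i : Fin P.n, ∀ c ∈ P.cands, c ∉ X →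
    (∀ x ∈ X, (P.ballot i).Pref x c) ∨ (∀ x ∈ X, (P.ballot i).Indiff x c) ∨
      (∀ x ∈ X, (P.ballot i).Pref c x)

open Classical in
/-- The profile in which all members of `X` except for `x ∈ X` have been removed. -/
noncomputable def removeClones (P : Profile C) (X : Finset C) (x : C) (hX : X ⊆ P.cands)
    (hx : x ∈ X) : Profile C :=
  P.restrict (insert x (P.cands \ X)) (Finset.insert_subset (hX hx) Finset.sdiff_subset)
    (Finset.insert_nonempty _ _)

end Profile

/-- Order types are the non-empty finite lists of positive integers. -/
def IsOrderType (τ : List ℕ) : Prop := τ ≠ [] ∧ ∀ k ∈ τ, 0 < k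

/-- A scoring system assigns to each order type `τ` a vector of `|τ|` nonnegative scores whose last
entry is zero. Entries are numbered from `0`, so `score τ j` is the entry `s(τ)_{j+1}`; only its
values at order types `τ` and indices `j < |τ|` have a meaning. -/
structure ScoringSystem where
  score : List ℕ → ℕ → ℝ
  nonneg : ∀ τ, IsOrderType τ → ∀ j, j < τ.length → 0 ≤ score τ j
  last_eq_zero : ∀ τ, IsOrderType τ → score τ (τ.length - 1) = 0

/-- A scoring system is monotone if better positions never receive a lower score. -/
def ScoringSystem.IsMonotone (s : ScoringSystem) : Prop :=
  ∀ τ, IsOrderType τ → ∀ i j, i ≤ j → j < τ.length → s.score τ j ≤ s.score τ i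

/-- The approval scoring system `s(τ) = (1, 0, …, 0)`. Since last entries are zero, the order type
with a single indifference class gets the vector `(0)`. -/
noncomputable def ScoringSystem.approval : ScoringSystem where
  score τ j := if j = 0 ∧ 2 ≤ τ.length then 1 else 0
  nonneg τ _ j _ := by split_ifs <;> norm_num
  last_eq_zero τ _ := by rw [if_neg]; omega

/-- A voting rule maps each profile to a non-empty set of tied winners among its alternatives. -/
structure VotingRule (C : Type u) where
  winners : Profile C → Set C
  winners_nonempty : ∀ P, (winners P).Nonempty
  winners_subset : ∀ P, winners P ⊆ (P.cands : Set C)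

section EliminationScoring

variable {C : Type u}

/-- The score of the alternative `c` in the profile `P`. -/
noncomputable def Profile.score (P : Profile C) (s : ScoringSystem) (c : C) : ℝ :=
  ∑ i : Fin P.n, s.score (P.ballot i).orderType ((P.ballot i).rank c)

/-- The set of lowest-scoring alternatives. -/
def Profile.lowest (P : Profile C) (s : ScoringSystem) : Set C :=
  {c | c ∈ P.cands ∧ ∀ d ∈ P.cands, P.score s c ≤ P.score s d}

open Classical in
/-- The profile in which the alternative `c` has been deleted. -/
noncomputable def Profile.delete (P : Profile C) (c : C) (h : 2 ≤ #P.cands) : Profile C :=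
  P.restrict (P.cands.erase c) (Finset.erase_subset _ _)
    (Finset.card_pos.1 (lt_of_lt_of_le (by omega) Finset.pred_card_le_card_erase))

theorem Profile.card_delete_lt (P : Profile C) (c : C) (h : 2 ≤ #P.cands) (hc : c ∈ P.cands) :
    #(P.delete c h).cands < #P.cands := by
  classical
  exact lt_of_eq_of_lt (congrArg Finset.card (by simp only [Profile.delete, Profile.restrict]))
    (Finset.card_erase_lt_of_mem hc)

/-- The winners under sequential elimination of a lowest-scoring alternative, with
parallel-universe tie-breaking. -/
noncomputable def eliminationWinners (s : ScoringSystem) (P : Profile C) : Set C :=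
  if h : 2 ≤ #P.cands then
    ⋃ c : {c : C // c ∈ P.lowest s}, eliminationWinners s (P.delete c.1 h)
  else (P.cands : Set C)
termination_by #P.cands
decreasing_by exact P.card_delete_lt c.1 h c.2.1

theorem Profile.lowest_nonempty (P : Profile C) (s : ScoringSystem) : (P.lowest s).Nonempty := by
  obtain ⟨c, hc, h⟩ := P.cands.exists_min_image (P.score s) P.cands_nonempty
  exact ⟨c, hc, h⟩

theorem eliminationWinners_nonempty_subset (s : ScoringSystem) (m : ℕ) :
    ∀ P : Profile C, #P.cands = m →
      (eliminationWinners s P).Nonempty ∧ eliminationWinners s P ⊆ (P.cands : Set C) := by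
  classical
  induction m using Nat.strong_induction_on with
  | _ m ih =>
    intro P hP
    rw [eliminationWinners]
    split_ifs with h
    · have key : ∀ c ∈ P.lowest s, _ := fun c hc =>
        ih _ (hP ▸ P.card_delete_lt c h hc.1) (P.delete c h) rfl
      constructor
      · obtain ⟨c, hc⟩ := P.lowest_nonempty s
        obtain ⟨x, hx⟩ := (key c hc).1
        exact ⟨x, Set.mem_iUnion.2 ⟨⟨c, hc⟩, hx⟩⟩
      · refine Set.iUnion_subset fun c x hx => ?_
        have := (key c.1 c.2).2 hx
        exact Finset.mem_coe.2 (Finset.mem_of_mem_erase (Finset.mem_coe.1 this))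
    · exact ⟨by exact_mod_cast P.cands_nonempty, subset_rfl⟩

end EliminationScoring

/-- The elimination scoring rule associated to a scoring system. -/
noncomputable def eliminationRule (C : Type u) (s : ScoringSystem) : VotingRule C where
  winners := eliminationWinners s
  winners_nonempty P := (eliminationWinners_nonempty_subset s _ P rfl).1
  winners_subset P := (eliminationWinners_nonempty_subset s _ P rfl).2

/-- Approval-IRV. -/
noncomputable def approvalIRV (C : Type u) : VotingRule C :=
  eliminationRule C ScoringSystem.approval

namespace VotingRule

variable {C : Type u}

/-- An elimination scoring rule is the rule associated to some monotone scoring system. -/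
def IsEliminationScoringRule (f : VotingRule C) : Prop :=
  ∃ s : ScoringSystem, s.IsMonotone ∧ f = eliminationRule C s

def IndependentOfClones (f : VotingRule C) : Prop :=
  ∀ (P : Profile C) (X : Finset C) (hX : P.IsCloneSet X) (x' : C) (hx' : x' ∈ X),
    (∀ c ∈ P.cands, c ∉ X →
      (c ∈ f.winners P ↔ c ∈ f.winners (P.removeClones X x' hX.2.1 hx'))) ∧
    (x' ∈ f.winners (P.removeClones X x' hX.2.1 hx') ↔ ∃ x ∈ X, x ∈ f.winners P)

def RespectsCohesiveMajorities (f : VotingRule C) : Prop :=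
  ∀ (P : Profile C) (S : Finset (Fin P.n)), (P.n : ℝ) / 2 < #S →
    (⋂ i ∈ S, P.top i).Nonempty → f.winners P ⊆ ⋃ i ∈ S, P.top i

end VotingRule

end Voting

/-! Approval-IRV satisfies both axioms by induction on the number of alternatives. If a jointly
approved alternative is eliminated, every survivor has majority approval, and two majorities
intersect (`approval_cohesive`). Merging clones never lowers an approval count, and leaves it
unchanged for an alternative without clones, so eliminations can be matched
(`IsQuotient.mem_approval_iff`). For the converse, elimination only compares scores within one
candidate set, so it suffices that on each set `A` with at least two elements the scores are a
positive multiple of approval scores (`IsApprovalOn`); the factor may depend on `A`. This is shown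
by induction on `m = #A`. Let α and κ be the scores of the first two places of a strict ballot (`lin
m 0`, `lin m 1`) and β the score of the large tie above a single bottom alternative (`bot m`). Most
steps use one pattern: a majority jointly approves `a`, but `a` is a lowest scorer and may go first;
on the smaller set the rule is already Approval-IRV and elects some `d` that nobody in the majority
approves. This gives α > 0, β ≤ α and, for m ≥ 3, κ = 0; once β = α it forces approval scores for
every other order type (`isApprovalOn_of_bot_eq_lin`). What remains is β = α. For m = 2 both are
scores of the same order type. For m ≥ 4, clones reduce the question to three alternatives, where
the induction hypothesis applies (`lin_le_bot_of_four_le`). For m = 3, the majority pattern gives β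
= α or 2β ≤ α (`two_mul_bot_le_lin_of_lt`), and the second case is refuted by profiles with a fourth
alternative (`seven_mul_bot_lt`, `lin_three_lt_two_mul_bot`). -/

open scoped Finset

namespace Voting

/-! ### Level functions, ranks and order types of weak orders -/

namespace WeakOrder

variable {C : Type*} {A : Finset C}

theorem ext_rel {R R' : WeakOrder A} (h : ∀ a b, R.rel a b ↔ R'.rel a b) : R = R' := by
  have : R.rel = R'.rel := by
    funext a b
    exact propext (h a b)
  cases R
  cases R'
  cases this
  rfl

/-- The weak order on `A` in which lower levels are better. -/
def ofLevel (A : Finset C) (g : C → ℕ) : WeakOrder A where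
  rel a b := a ∈ A ∧ b ∈ A ∧ g a ≤ g b
  mem_of_rel _ _ h := ⟨h.1, h.2.1⟩
  complete a ha b hb := (le_total (g a) (g b)).imp (fun h => ⟨ha, hb, h⟩) fun h => ⟨hb, ha, h⟩
  transitive _ _ _ h h' := ⟨h.1, h'.2.1, h.2.2.trans h'.2.2⟩

/-- The function `g` represents the weak order `R`. -/
def IsLevel (R : WeakOrder A) (g : C → ℕ) : Prop :=
  ∀ a ∈ A, ∀ b ∈ A, R.rel a b ↔ g a ≤ g b

theorem isLevel_ofLevel (A : Finset C) (g : C → ℕ) : (ofLevel A g).IsLevel g :=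
  fun _ ha _ hb => ⟨fun h => h.2.2, fun h => ⟨ha, hb, h⟩⟩

theorem restrict_ofLevel {B : Finset C} (g : C → ℕ) (hB : B ⊆ A) :
    (ofLevel A g).restrict B hB = ofLevel B g :=
  ext_rel fun _ _ => ⟨fun h => ⟨h.2.1, h.2.2, h.1.2.2⟩, fun h => ⟨⟨hB h.1, hB h.2.1, h.2.2⟩, h.1, h.2.1⟩⟩

theorem IsLevel.pref_iff {R : WeakOrder A} {g : C → ℕ} (h : R.IsLevel g) {a b : C} (ha : a ∈ A)
    (hb : b ∈ A) : R.Pref a b ↔ g a < g b := by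
  rw [Pref, h a ha b hb, h b hb a ha]
  omega

theorem IsLevel.indiff_iff {R : WeakOrder A} {g : C → ℕ} (h : R.IsLevel g) {a b : C} (ha : a ∈ A)
    (hb : b ∈ A) : R.Indiff a b ↔ g a = g b := by
  rw [Indiff, h a ha b hb, h b hb a ha]
  omega

theorem IsLevel.card_image_indiffClass {R : WeakOrder A} {g : C → ℕ} (h : R.IsLevel g)
    [DecidableEq (Finset C)] {B : Finset C} (hB : B ⊆ A) :
    #(B.image R.indiffClass) = #(B.image g) := by
  classical
  let F : ℕ → Finset C := fun j => {b ∈ A | j = g b}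
  have h1 : B.image R.indiffClass = (B.image g).image F := by
    rw [Finset.image_image]
    refine Finset.image_congr fun a ha => ?_
    have ha' := hB ha
    ext b
    simp only [indiffClass, F, Function.comp, Finset.mem_filter]
    exact and_congr_right fun hb => h.indiff_iff ha' hb
  rw [h1]
  refine Finset.card_image_of_injOn fun i hi j _ hij => ?_
  obtain ⟨b, hb, rfl⟩ := Finset.mem_image.1 (Finset.mem_coe.1 hi)
  have : b ∈ F j := by
    rw [← show F (g b) = F j from hij]
    simp [F, hB hb]
  exact ((Finset.mem_filter.1 this).2).symm

theorem IsLevel.rank_eq {R : WeakOrder A} {g : C → ℕ} (h : R.IsLevel g) {c : C} (hc : c ∈ A) :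
    R.rank c = #{j ∈ A.image g | j < g c} := by
  classical
  rw [rank, h.card_image_indiffClass (Finset.filter_subset _ _), Finset.filter_image]
  congr 2
  exact Finset.filter_congr fun a ha => h.pref_iff ha hc

theorem exists_isLevel (R : WeakOrder A) : ∃ g, R.IsLevel g := by
  classical
  refine ⟨fun c => #{b ∈ A | R.Pref b c}, fun a ha b hb => ⟨fun hab => ?_, fun hle => ?_⟩⟩
  · refine Finset.card_le_card fun x hx => ?_
    rw [Finset.mem_filter] at hx ⊢
    exact ⟨hx.1, R.transitive _ _ _ hx.2.1 hab, fun h => hx.2.2 (R.transitive _ _ _ hab h)⟩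
  · by_contra hab
    have hba := (R.complete a ha b hb).resolve_left hab
    refine absurd hle (not_le.2 (Finset.card_lt_card ⟨fun x hx => ?_, fun hsub => ?_⟩))
    · rw [Finset.mem_filter] at hx ⊢
      exact ⟨hx.1, R.transitive _ _ _ hx.2.1 hba, fun h => hx.2.2 (R.transitive _ _ _ hba h)⟩
    · have hb' : b ∈ ({x ∈ A | R.Pref x a} : Finset C) := Finset.mem_filter.2 ⟨hb, hba, hab⟩
      have := (Finset.mem_filter.1 (hsub hb')).2
      exact this.2 this.1

theorem isLevel_rank (R : WeakOrder A) : R.IsLevel R.rank := by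
  classical
  obtain ⟨g, hg⟩ := R.exists_isLevel
  intro a ha b hb
  rw [hg a ha b hb, hg.rank_eq ha, hg.rank_eq hb]
  constructor
  · intro h
    refine Finset.card_le_card fun j hj => ?_
    rw [Finset.mem_filter] at hj ⊢
    exact ⟨hj.1, hj.2.trans_le h⟩
  · intro h
    by_contra hlt
    rw [not_le] at hlt
    refine absurd h (not_le.2 (Finset.card_lt_card ⟨fun j hj => ?_, fun hsub => ?_⟩))
    · rw [Finset.mem_filter] at hj ⊢
      exact ⟨hj.1, hj.2.trans hlt⟩
    · have := hsub (Finset.mem_filter.2 ⟨Finset.mem_image_of_mem g hb, hlt⟩)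
      exact absurd (Finset.mem_filter.1 this).2 (lt_irrefl _)

/-- Every ballot is thus given by a level function, so profiles can be built and scores studied
through functions `C → ℕ` alone. -/
theorem ofLevel_rank (R : WeakOrder A) : ofLevel A R.rank = R :=
  ext_rel fun a b => ⟨fun h => (R.isLevel_rank a h.1 b h.2.1).2 h.2.2, fun h =>
    have hm := R.mem_of_rel a b h
    ⟨hm.1, hm.2, (R.isLevel_rank a hm.1 b hm.2).1 h⟩⟩

theorem length_orderType (R : WeakOrder A) : R.orderType.length = #(A.image R.rank) := by
  classical
  rw [orderType, List.length_ofFn, R.isLevel_rank.card_image_indiffClass subset_rfl]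

theorem IsLevel.length_orderType {R : WeakOrder A} {g : C → ℕ} (h : R.IsLevel g) :
    R.orderType.length = #(A.image g) := by
  classical
  rw [orderType, List.length_ofFn, h.card_image_indiffClass subset_rfl]

/-- A rank counts the level values strictly below its own, so it is less than the number of classes;
as there are as many ranks as classes, none is skipped. -/
theorem image_rank (R : WeakOrder A) : A.image R.rank = Finset.range R.orderType.length := by
  rw [R.length_orderType]
  refine Finset.eq_of_subset_of_card_le (fun j hj => ?_) (by rw [Finset.card_range])
  obtain ⟨c, hc, rfl⟩ := Finset.mem_image.1 hj
  rw [Finset.mem_range]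
  conv_lhs => rw [R.isLevel_rank.rank_eq hc]
  exact Finset.card_lt_card (Finset.filter_ssubset.2 ⟨_, hj, lt_irrefl _⟩)

theorem rank_lt_length (R : WeakOrder A) {c : C} (hc : c ∈ A) : R.rank c < R.orderType.length := by
  rw [← Finset.mem_range, ← R.image_rank]
  exact Finset.mem_image_of_mem _ hc

theorem exists_rank_eq (R : WeakOrder A) {j : ℕ} (hj : j < R.orderType.length) :
    ∃ c ∈ A, R.rank c = j := by
  rwa [← Finset.mem_range, ← R.image_rank, Finset.mem_image] at hj

theorem orderType_eq_map (R : WeakOrder A) :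
    R.orderType = (List.range #(A.image R.rank)).map fun j => #{c ∈ A | R.rank c = j} := by
  refine List.ext_getElem (by rw [R.length_orderType]; simp) fun i h1 h2 => ?_
  simp only [orderType, List.getElem_ofFn, List.getElem_map, List.getElem_range]

theorem isOrderType_orderType (R : WeakOrder A) (hA : A.Nonempty) : IsOrderType R.orderType := by
  obtain ⟨a, ha⟩ := hA
  refine ⟨List.ne_nil_of_length_pos ((Nat.zero_le _).trans_lt (R.rank_lt_length ha)), ?_⟩
  intro k hk
  rw [orderType_eq_map, List.mem_map] at hk
  obtain ⟨j, hj, rfl⟩ := hk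
  rw [List.mem_range, ← R.length_orderType] at hj
  obtain ⟨c, hc, hcj⟩ := R.exists_rank_eq hj
  exact Finset.card_pos.2 ⟨c, Finset.mem_filter.2 ⟨hc, hcj⟩⟩

theorem rank_eq_zero_iff (R : WeakOrder A) {c : C} (hc : c ∈ A) :
    R.rank c = 0 ↔ ∀ d ∈ A, R.rel c d := by
  constructor
  · intro h d hd
    rw [R.isLevel_rank c hc d hd, h]
    exact Nat.zero_le _
  · intro h
    obtain ⟨d, hd, hd0⟩ := R.exists_rank_eq ((Nat.zero_le _).trans_lt (R.rank_lt_length hc))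
    have := (R.isLevel_rank c hc d hd).1 (h d hd)
    omega

theorem orderType_of_injOn {R : WeakOrder A} {g : C → ℕ} (h : R.IsLevel g)
    (hg : Set.InjOn g (A : Set C)) : R.orderType = List.replicate #A 1 := by
  have hinj : Set.InjOn R.rank (A : Set C) := fun a ha b hb hab => by
    refine hg ha hb (le_antisymm ?_ ?_)
    · exact (h a ha b hb).1 ((R.isLevel_rank a ha b hb).2 hab.le)
    · exact (h b hb a ha).1 ((R.isLevel_rank b hb a ha).2 hab.ge)
  have hcard := Finset.card_image_of_injOn hinj
  rw [List.eq_replicate_iff, R.length_orderType, hcard]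
  refine ⟨rfl, fun k hk => ?_⟩
  rw [orderType_eq_map, List.mem_map] at hk
  obtain ⟨j, hj, rfl⟩ := hk
  rw [List.mem_range, ← R.length_orderType] at hj
  obtain ⟨c, hc, rfl⟩ := R.exists_rank_eq hj
  rw [Finset.card_eq_one]
  refine ⟨c, Finset.ext fun b => ?_⟩
  rw [Finset.mem_filter, Finset.mem_singleton]
  exact ⟨fun hb => hinj hb.1 hc hb.2, by rintro rfl; exact ⟨hc, rfl⟩⟩

theorem rank_ofLevel_eq {g : C → ℕ} {k : ℕ} (h : A.image g = Finset.range k) {c : C} (hc : c ∈ A) :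
    (ofLevel A g).rank c = g c := by
  rw [(isLevel_ofLevel A g).rank_eq hc, h]
  have hlt : g c < k := by
    rw [← Finset.mem_range, ← h]
    exact Finset.mem_image_of_mem _ hc
  rw [show ({j ∈ Finset.range k | j < g c} : Finset ℕ) = Finset.range (g c) by ext; simp; omega,
    Finset.card_range]

theorem rank_ofLevel_eq_zero {g : C → ℕ} {c : C} (hc : c ∈ A) :
    (ofLevel A g).rank c = 0 ↔ ∀ d ∈ A, g c ≤ g d := by
  rw [rank_eq_zero_iff _ hc]
  exact forall₂_congr fun d hd => isLevel_ofLevel A g c hc d hd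

open Classical in
/-- The level function of the ballot on which `d` is at the bottom and everybody else is tied. -/
noncomputable def bottomLevel (d : C) (c : C) : ℕ := if c = d then 1 else 0

theorem image_bottomLevel {d : C} (hd : d ∈ A) (hA : 2 ≤ #A) :
    A.image (bottomLevel d) = Finset.range 2 := by
  obtain ⟨e, he, hne⟩ := Finset.exists_mem_ne (by omega : 1 < #A) d
  ext j
  simp only [Finset.mem_image, Finset.mem_range]
  constructor
  · rintro ⟨c, _, rfl⟩
    rw [bottomLevel]
    split_ifs <;> omega
  · intro hj
    interval_cases j
    · exact ⟨e, he, if_neg hne⟩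
    · exact ⟨d, hd, if_pos rfl⟩

theorem orderType_bottomLevel {d : C} (hd : d ∈ A) (hA : 2 ≤ #A) :
    (ofLevel A (bottomLevel d)).orderType = [#A - 1, 1] := by
  classical
  have hr : ∀ c ∈ A, (ofLevel A (bottomLevel d)).rank c = bottomLevel d c := fun c hc =>
    rank_ofLevel_eq (image_bottomLevel hd hA) hc
  rw [orderType_eq_map, ← length_orderType, (isLevel_ofLevel A (bottomLevel d)).length_orderType,
    image_bottomLevel hd hA, Finset.card_range]
  have h0 : #{c ∈ A | (ofLevel A (bottomLevel d)).rank c = 0} = #A - 1 := by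
    rw [← Finset.card_erase_of_mem hd]
    congr 1
    ext c
    rw [Finset.mem_filter, Finset.mem_erase, and_comm]
    refine and_congr_left fun hc => ?_
    rw [hr c hc, bottomLevel]
    split_ifs <;> simp_all
  have h1 : #{c ∈ A | (ofLevel A (bottomLevel d)).rank c = 1} = 1 := by
    rw [Finset.card_eq_one]
    refine ⟨d, Finset.ext fun c => ?_⟩
    rw [Finset.mem_filter, Finset.mem_singleton]
    constructor
    · rintro ⟨hc, h⟩
      rw [hr c hc, bottomLevel] at h
      by_contra hne
      simp [hne] at h
    · rintro rfl
      exact ⟨hd, by rw [hr c hd, bottomLevel, if_pos rfl]⟩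
  simp [List.range_succ, h0, h1]

end WeakOrder

end Voting

/-! ### Approval scoring, and the two axioms for Approval-IRV -/

namespace Voting

variable {C : Type*}

/-- On ballots over `A`, the scoring system is a positive multiple of approval scoring. -/
def ScoringSystem.IsApprovalOn (s : ScoringSystem) (A : Finset C) : Prop :=
  ∃ α : ℝ, 0 < α ∧ ∀ R : WeakOrder A, 2 ≤ R.orderType.length → ∀ c ∈ A,
    s.score R.orderType (R.rank c) = if R.rank c = 0 then α else 0

theorem ScoringSystem.isApprovalOn_approval (A : Finset C) :
    ScoringSystem.approval.IsApprovalOn A :=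
  ⟨1, one_pos, fun R hR c _ => by simp [ScoringSystem.approval, hR]⟩

theorem ScoringSystem.isMonotone_approval : ScoringSystem.approval.IsMonotone := by
  intro τ _ i j hij _
  simp only [ScoringSystem.approval]
  split_ifs <;> first | omega | norm_num

namespace Profile

/-- The number of voters with `c` among their top alternatives. -/
noncomputable def topCount (P : Profile C) (c : C) : ℕ := #{i | (P.ballot i).rank c = 0}

/-- A completely tied ballot scores 0 for everybody but enters every `topCount`. The constant `K`
corrects for such ballots and does not affect comparisons. -/
theorem exists_score_eq (P : Profile C) {s : ScoringSystem} (hs : s.IsApprovalOn P.cands) :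
    ∃ α K : ℝ, 0 < α ∧ ∀ c ∈ P.cands, P.score s c = α * P.topCount c - K := by
  obtain ⟨α, hα, h⟩ := hs
  refine ⟨α, ∑ i, if 2 ≤ (P.ballot i).orderType.length then 0 else α, hα, fun c hc => ?_⟩
  rw [topCount, Finset.card_filter, score, Nat.cast_sum, Finset.mul_sum, ← Finset.sum_sub_distrib]
  refine Finset.sum_congr rfl fun i _ => ?_
  by_cases h2 : 2 ≤ (P.ballot i).orderType.length
  · rw [h _ h2 c hc, if_pos h2]
    split_ifs <;> simp
  · have hr := (P.ballot i).rank_lt_length hc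
    have h0 : (P.ballot i).rank c = (P.ballot i).orderType.length - 1 := by omega
    have h1 := s.last_eq_zero _ ((P.ballot i).isOrderType_orderType ⟨c, hc⟩)
    rw [← h0] at h1
    rw [h1, if_neg h2, if_pos (by omega : (P.ballot i).rank c = 0)]
    simp

theorem mem_lowest_iff (P : Profile C) {s : ScoringSystem} (hs : s.IsApprovalOn P.cands) {c : C} :
    c ∈ P.lowest s ↔ c ∈ P.cands ∧ ∀ d ∈ P.cands, P.topCount c ≤ P.topCount d := by
  obtain ⟨α, K, hα, h⟩ := P.exists_score_eq hs
  refine and_congr_right fun hc => forall₂_congr fun d hd => ?_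
  rw [h c hc, h d hd, sub_le_sub_iff_right, mul_le_mul_iff_right₀ hα, Nat.cast_le]

theorem mem_top_iff (P : Profile C) {i : Fin P.n} {c : C} :
    c ∈ P.top i ↔ c ∈ P.cands ∧ (P.ballot i).rank c = 0 :=
  and_congr_right fun hc => ((P.ballot i).rank_eq_zero_iff hc).symm

end Profile

theorem mem_eliminationWinners_iff {s : ScoringSystem} {P : Profile C} (h : 2 ≤ #P.cands) {w : C} :
    w ∈ eliminationWinners s P ↔
      ∃ c ∈ P.lowest s, w ∈ eliminationWinners s (P.delete c h) := by
  rw [eliminationWinners, dif_pos h]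
  simp

theorem eliminationWinners_of_card_lt {s : ScoringSystem} {P : Profile C} (h : #P.cands < 2) :
    eliminationWinners s P = (P.cands : Set C) := by
  rw [eliminationWinners, dif_neg (by omega)]

theorem mem_cands_of_mem_eliminationWinners {s : ScoringSystem} {P : Profile C} {w : C}
    (h : w ∈ eliminationWinners s P) : w ∈ P.cands :=
  (eliminationWinners_nonempty_subset s _ P rfl).2 h

theorem Profile.mem_cands_delete {P : Profile C} {c x : C} (h : 2 ≤ #P.cands) :
    x ∈ (P.delete c h).cands ↔ x ≠ c ∧ x ∈ P.cands := by
  classical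
  simp [Profile.delete, Profile.restrict]

/-- The lowest scorers depend only on `topCount`, so the factors may differ between the two systems
and from one set to another. -/
theorem eliminationWinners_congr {s s' : ScoringSystem} (m : ℕ)
    (hs : ∀ B : Finset C, 2 ≤ #B → #B ≤ m → s.IsApprovalOn B)
    (hs' : ∀ B : Finset C, 2 ≤ #B → #B ≤ m → s'.IsApprovalOn B) (P : Profile C)
    (hP : #P.cands ≤ m) : eliminationWinners s P = eliminationWinners s' P := by
  induction hk : #P.cands using Nat.strong_induction_on generalizing P with
  | _ k ih =>
    by_cases h : 2 ≤ #P.cands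
    · ext w
      rw [mem_eliminationWinners_iff h, mem_eliminationWinners_iff h]
      refine exists_congr fun c => ?_
      rw [P.mem_lowest_iff (hs _ h hP), P.mem_lowest_iff (hs' _ h hP)]
      refine and_congr_right fun hc => ?_
      have hlt := P.card_delete_lt c h hc.1
      rw [ih _ (hk ▸ hlt) _ (hlt.le.trans hP) rfl]
    · rw [eliminationWinners_of_card_lt (by omega), eliminationWinners_of_card_lt (by omega)]

/-- If `c` goes first, then `w` has at least as many approvals as `c`, hence a majority, which meets
`S`. If another alternative goes first, the voter found by induction ranks `w` as high as `c`, which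
is on top of the full ballot. -/
theorem approval_cohesive (P : Profile C) {c w : C} (hc : c ∈ P.cands) (S : Finset (Fin P.n))
    (hS : P.n < 2 * #S) (htop : ∀ i ∈ S, (P.ballot i).rank c = 0)
    (hw : w ∈ eliminationWinners ScoringSystem.approval P) : ∃ i ∈ S, w ∈ P.top i := by
  induction hk : #P.cands using Nat.strong_induction_on generalizing P with
  | _ k ih =>
    have hwA := mem_cands_of_mem_eliminationWinners hw
    by_cases h : 2 ≤ #P.cands
    · obtain ⟨d, hd, hwd⟩ := (mem_eliminationWinners_iff h).1 hw
      by_cases hdc : d = c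
      · subst hdc
        have hle := ((P.mem_lowest_iff (ScoringSystem.isApprovalOn_approval _)).1 hd).2 w hwA
        have hSle : #S ≤ P.topCount d :=
          Finset.card_le_card fun i hi => by simpa using htop i hi
        obtain ⟨i, hi⟩ := Finset.inter_nonempty_of_card_lt_card_add_card
          (Finset.subset_univ S) (Finset.subset_univ {i | (P.ballot i).rank w = 0})
          (by rw [Finset.card_univ, Fintype.card_fin]; unfold Profile.topCount at *; omega)
        rw [Finset.mem_inter, Finset.mem_filter] at hi
        exact ⟨i, hi.1, P.mem_top_iff.2 ⟨hwA, hi.2.2⟩⟩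
      · have hcd : c ∈ (P.delete d h).cands := (Profile.mem_cands_delete h).2 ⟨Ne.symm hdc, hc⟩
        obtain ⟨i, hi, hit⟩ := ih _ (hk ▸ P.card_delete_lt d h hd.1) (P.delete d h) hcd S hS
          (fun i hi => ((WeakOrder.rank_eq_zero_iff _ hcd)).2 fun e he =>
            ⟨((P.ballot i).rank_eq_zero_iff hc).1 (htop i hi) e
              ((Profile.mem_cands_delete h).1 he).2, hcd, he⟩) hwd rfl
        refine ⟨i, hi, hwA, fun e he => ?_⟩
        have h1 : (P.ballot i).rel w c := (hit.2 c hcd).1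
        exact (P.ballot i).transitive _ _ _ h1
          (((P.ballot i).rank_eq_zero_iff hc).1 (htop i hi) e he)
    · have : w = c := Finset.card_le_one.1 (by omega : #P.cands ≤ 1) w hwA c hc
      have hpos : 0 < #S := by omega
      obtain ⟨i, hi⟩ := Finset.card_pos.1 hpos
      exact ⟨i, hi, P.mem_top_iff.2 ⟨hwA, this ▸ htop i hi⟩⟩

section Quotient

variable {n : ℕ} {A B : Finset C}

/-- The ballots over `B` arise from those over `A` by merging the clone sets that are the fibres of
`φ`. -/
structure IsQuotient (R : Fin n → WeakOrder A) (R' : Fin n → WeakOrder B) (φ : C → C) : Prop where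
  mapsTo : ∀ a ∈ A, φ a ∈ B
  surj : ∀ b ∈ B, ∃ a ∈ A, φ a = b
  rel_iff : ∀ i, ∀ a ∈ A, ∀ a' ∈ A, φ a ≠ φ a' → ((R i).rel a a' ↔ (R' i).rel (φ a) (φ a'))

variable {R : Fin n → WeakOrder A} {R' : Fin n → WeakOrder B} {φ : C → C}

theorem IsQuotient.rank_eq_zero (hq : IsQuotient R R' φ) {i : Fin n} {a : C} (ha : a ∈ A)
    (h : (R i).rank a = 0) : (R' i).rank (φ a) = 0 := by
  rw [WeakOrder.rank_eq_zero_iff _ ha] at h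
  rw [WeakOrder.rank_eq_zero_iff _ (hq.mapsTo a ha)]
  intro b hb
  obtain ⟨a', ha', rfl⟩ := hq.surj b hb
  by_cases hne : φ a = φ a'
  · rw [← hne]
    exact ((R' i).complete _ (hq.mapsTo a ha) _ (hq.mapsTo a ha)).elim id id
  · exact (hq.rel_iff i a ha a' ha' hne).1 (h a' ha')

theorem IsQuotient.rank_eq_zero_iff (hq : IsQuotient R R' φ) {i : Fin n} {a : C} (ha : a ∈ A)
    (hfib : ∀ a' ∈ A, φ a' = φ a → a' = a) : (R i).rank a = 0 ↔ (R' i).rank (φ a) = 0 := by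
  refine ⟨hq.rank_eq_zero ha, fun h => ?_⟩
  rw [WeakOrder.rank_eq_zero_iff _ (hq.mapsTo a ha)] at h
  rw [WeakOrder.rank_eq_zero_iff _ ha]
  intro a' ha'
  by_cases hne : φ a = φ a'
  · rw [hfib a' ha' hne.symm]
    exact ((R i).complete _ ha _ ha).elim id id
  · exact (hq.rel_iff i a ha a' ha' hne).2 (h _ (hq.mapsTo a' ha'))

theorem IsQuotient.topCount_le (hq : IsQuotient R R' φ) (hA : A.Nonempty) (hB : B.Nonempty) {a : C}
    (ha : a ∈ A) : (Profile.mk A hA n R).topCount a ≤ (Profile.mk B hB n R').topCount (φ a) :=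
  Finset.card_le_card fun i hi => by
    simp only [Finset.mem_filter, Finset.mem_univ, true_and] at hi ⊢
    exact hq.rank_eq_zero ha hi

theorem IsQuotient.topCount_eq (hq : IsQuotient R R' φ) (hA : A.Nonempty) (hB : B.Nonempty) {a : C}
    (ha : a ∈ A) (hfib : ∀ a' ∈ A, φ a' = φ a → a' = a) :
    (Profile.mk A hA n R).topCount a = (Profile.mk B hB n R').topCount (φ a) := by
  refine congrArg Finset.card (Finset.filter_congr fun i _ => ?_)
  exact hq.rank_eq_zero_iff ha hfib

theorem IsQuotient.restrict (hq : IsQuotient R R' φ) {A' B' : Finset C} (hA : A' ⊆ A) (hB : B' ⊆ B)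
    (hm : ∀ a ∈ A', φ a ∈ B') (hsurj : ∀ b ∈ B', ∃ a ∈ A', φ a = b) :
    IsQuotient (fun i => (R i).restrict A' hA) (fun i => (R' i).restrict B' hB) φ where
  mapsTo := hm
  surj := hsurj
  rel_iff i a ha a' ha' hne := by
    simp only [WeakOrder.restrict]
    rw [hq.rel_iff i a (hA ha) a' (hA ha') hne]
    simp [ha, ha', hm]

theorem IsQuotient.restrict_left (hq : IsQuotient R R' φ) {A' : Finset C} (hA : A' ⊆ A)
    (hsurj : ∀ b ∈ B, ∃ a ∈ A', φ a = b) :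
    IsQuotient (fun i => (R i).restrict A' hA) R' φ where
  mapsTo a ha := hq.mapsTo a (hA ha)
  surj := hsurj
  rel_iff i a ha a' ha' hne := by
    simp only [WeakOrder.restrict]
    rw [hq.rel_iff i a (hA ha) a' (hA ha') hne]
    simp [ha, ha']

/-- A map `φ` is used instead of a representative inside `A` because the representative may be
eliminated before its clones. Removing an alternative with a twin keeps the quotient. For an
alternative alone in its fibre the counts on both sides agree, and elsewhere they can only grow
under `φ`, so lowest scorers correspond. -/
theorem IsQuotient.mem_approval_iff (hq : IsQuotient R R' φ) (hA : A.Nonempty) (hB : B.Nonempty)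
    (b : C) :
    b ∈ eliminationWinners ScoringSystem.approval (Profile.mk B hB n R') ↔
      ∃ a ∈ eliminationWinners ScoringSystem.approval (Profile.mk A hA n R), φ a = b := by
  classical
  induction hk : #A using Nat.strong_induction_on generalizing A B b with
  | _ k ih =>
    set P := Profile.mk A hA n R with hP
    set Q := Profile.mk B hB n R' with hQ
    have hPlow : ∀ {c}, c ∈ P.lowest .approval ↔ c ∈ A ∧ ∀ d ∈ A, P.topCount c ≤ P.topCount d :=
      fun {c} => P.mem_lowest_iff (ScoringSystem.isApprovalOn_approval _)
    have hQlow : ∀ {c}, c ∈ Q.lowest .approval ↔ c ∈ B ∧ ∀ d ∈ B, Q.topCount c ≤ Q.topCount d :=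
      fun {c} => Q.mem_lowest_iff (ScoringSystem.isApprovalOn_approval _)
    by_cases hA2 : 2 ≤ #A
    swap
    · obtain ⟨a, rfl⟩ : ∃ a, A = {a} := Finset.card_eq_one.1 (by have := hA.card_pos; omega)
      obtain rfl : B = {φ a} := by
        ext b
        rw [Finset.mem_singleton]
        refine ⟨fun hb => ?_, fun hb => hb ▸ hq.mapsTo a (by simp)⟩
        obtain ⟨a', ha', rfl⟩ := hq.surj b hb
        rw [Finset.mem_singleton.1 ha']
      rw [eliminationWinners_of_card_lt (show #({a} : Finset C) < 2 by simp),
        eliminationWinners_of_card_lt (show #({φ a} : Finset C) < 2 by simp)]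
      simp [hP, hQ, eq_comm]
    -- deleting an alternative with a twin does not change the quotient
    have htwin : ∀ d ∈ A, (∃ a ∈ A, φ a = φ d ∧ a ≠ d) →
        (b ∈ eliminationWinners ScoringSystem.approval Q ↔
          ∃ a ∈ eliminationWinners ScoringSystem.approval (P.delete d hA2), φ a = b) := by
      rintro d hd ⟨e, he, hed, hne⟩
      refine ih _ (hk ▸ Finset.card_erase_lt_of_mem hd)
        (hq.restrict_left (Finset.erase_subset _ _) fun b hb => ?_) _ hB b rfl
      obtain ⟨a, ha, rfl⟩ := hq.surj b hb
      by_cases had : a = d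
      · exact ⟨e, Finset.mem_erase.2 ⟨hne, he⟩, hed.trans (by rw [had])⟩
      · exact ⟨a, Finset.mem_erase.2 ⟨had, ha⟩, rfl⟩
    -- deleting an alternative without twins on both sides
    have hsingle : ∀ d ∈ A, (∀ a ∈ A, φ a = φ d → a = d) → ∃ hB2 : 2 ≤ #B,
        (b ∈ eliminationWinners ScoringSystem.approval (Q.delete (φ d) hB2) ↔
          ∃ a ∈ eliminationWinners ScoringSystem.approval (P.delete d hA2), φ a = b) := by
      intro d hd hfib
      obtain ⟨e, he, hne⟩ := Finset.exists_mem_ne (by omega : 1 < #A) d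
      have hB2 : 2 ≤ #B := Finset.one_lt_card.2
        ⟨φ e, hq.mapsTo e he, φ d, hq.mapsTo d hd, fun h => hne (hfib e he h)⟩
      refine ⟨hB2, ih _ (hk ▸ Finset.card_erase_lt_of_mem hd)
        (hq.restrict (Finset.erase_subset _ _) (Finset.erase_subset _ _) (fun a ha => ?_)
          fun b hb => ?_) _ _ b rfl⟩
      · rw [Finset.mem_erase] at ha ⊢
        exact ⟨fun h => ha.1 (hfib a ha.2 h), hq.mapsTo a ha.2⟩
      · rw [Finset.mem_erase] at hb
        obtain ⟨a, ha, rfl⟩ := hq.surj b hb.2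
        exact ⟨a, Finset.mem_erase.2 ⟨fun h => hb.1 (by rw [h]), ha⟩, rfl⟩
    have hle : ∀ a ∈ A, P.topCount a ≤ Q.topCount (φ a) := fun a ha => hq.topCount_le hA hB ha
    have heq : ∀ a ∈ A, (∀ a' ∈ A, φ a' = φ a → a' = a) → P.topCount a = Q.topCount (φ a) :=
      fun a ha h => hq.topCount_eq hA hB ha h
    constructor
    · intro hb
      by_cases hex : ∃ d ∈ P.lowest .approval, ∃ a ∈ A, φ a = φ d ∧ a ≠ d
      · obtain ⟨d, hd, hd'⟩ := hex
        obtain ⟨a, ha, hab⟩ := (htwin d hd.1 hd').1 hb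
        exact ⟨a, (mem_eliminationWinners_iff hA2).2 ⟨d, hd, ha⟩, hab⟩
      · push Not at hex
        obtain ⟨d₀, hd₀⟩ := P.lowest_nonempty .approval
        obtain ⟨hB2, -⟩ := hsingle d₀ hd₀.1 (hex d₀ hd₀)
        obtain ⟨e, he, hbe⟩ := (mem_eliminationWinners_iff (P := Q) hB2).1 hb
        obtain ⟨d, hd, rfl⟩ := hq.surj e he.1
        have hdlow : d ∈ P.lowest .approval := by
          refine hPlow.2 ⟨hd, fun a ha => ?_⟩
          calc P.topCount d ≤ Q.topCount (φ d) := hle d hd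
            _ ≤ Q.topCount (φ d₀) := (hQlow.1 he).2 _ (hq.mapsTo _ hd₀.1)
            _ = P.topCount d₀ := (heq d₀ hd₀.1 (hex d₀ hd₀)).symm
            _ ≤ P.topCount a := (hPlow.1 hd₀).2 a ha
        obtain ⟨_, hiff⟩ := hsingle d hd (hex d hdlow)
        obtain ⟨a, ha, hab⟩ := hiff.1 hbe
        exact ⟨a, (mem_eliminationWinners_iff hA2).2 ⟨d, hdlow, ha⟩, hab⟩
    · rintro ⟨w, hw, hwb⟩
      obtain ⟨d, hd, hwd⟩ := (mem_eliminationWinners_iff (P := P) hA2).1 hw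
      by_cases hfib : ∃ a ∈ A, φ a = φ d ∧ a ≠ d
      · exact (htwin d hd.1 hfib).2 ⟨w, hwd, hwb⟩
      · push Not at hfib
        obtain ⟨hB2, hiff⟩ := hsingle d hd.1 hfib
        refine (mem_eliminationWinners_iff hB2).2 ⟨φ d, hQlow.2 ⟨hq.mapsTo d hd.1, ?_⟩,
          hiff.2 ⟨w, hwd, hwb⟩⟩
        intro b' hb'
        obtain ⟨a, ha, rfl⟩ := hq.surj b' hb'
        calc Q.topCount (φ d) = P.topCount d := (heq d hd.1 hfib).symm
          _ ≤ P.topCount a := (hPlow.1 hd).2 a ha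
          _ ≤ Q.topCount (φ a) := hle a ha

end Quotient

theorem approvalIRV_respectsCohesiveMajorities :
    (approvalIRV C).RespectsCohesiveMajorities := by
  rintro P S hS ⟨c, hc⟩ w hw
  rw [Set.mem_iInter₂] at hc
  have hS' : P.n < 2 * #S := by
    rw [div_lt_iff₀ two_pos] at hS
    exact_mod_cast (by linarith : (P.n : ℝ) < 2 * #S)
  obtain ⟨i, hi⟩ := Finset.card_pos.1 (by omega : 0 < #S)
  obtain ⟨j, hj, hw⟩ := approval_cohesive P (hc i hi).1 S hS'
    (fun i hi => (P.mem_top_iff.1 (hc i hi)).2) hw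
  exact Set.mem_iUnion₂.2 ⟨j, hj, hw⟩

theorem approvalIRV_independentOfClones : (approvalIRV C).IndependentOfClones := by
  classical
  intro P X hX x hx
  let φ : C → C := fun c => if c ∈ X then x else c
  have hin : ∀ c ∈ X, φ c = x := fun c hc => if_pos hc
  have hout : ∀ c ∉ X, φ c = c := fun c hc => if_neg hc
  have hq : IsQuotient P.ballot (P.removeClones X x hX.2.1 hx).ballot φ := by
    refine ⟨fun a ha => ?_, fun b hb => ?_, fun i a ha a' ha' hne => ?_⟩
    · by_cases haX : a ∈ X
      · rw [hin a haX]
        exact Finset.mem_insert_self _ _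
      · rw [hout a haX]
        exact Finset.mem_insert_of_mem (Finset.mem_sdiff.2 ⟨ha, haX⟩)
    · rcases Finset.mem_insert.1 hb with rfl | hb
      · exact ⟨b, hX.2.1 hx, hin b hx⟩
      · rw [Finset.mem_sdiff] at hb
        exact ⟨b, hb.1, hout b hb.2⟩
    · have hmem : ∀ c ∈ P.cands, c ∉ X → c ∈ insert x (P.cands \ X) := fun c hc hcX =>
        Finset.mem_insert_of_mem (Finset.mem_sdiff.2 ⟨hc, hcX⟩)
      have hxm := Finset.mem_insert_self x (P.cands \ X)
      simp only [Profile.removeClones, Profile.restrict, WeakOrder.restrict]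
      by_cases haX : a ∈ X <;> by_cases haX' : a' ∈ X
      · exact absurd ((hin a haX).trans (hin a' haX').symm) hne
      · rw [hin a haX, hout a' haX']
        have h := hX.2.2 i a' ha' haX'
        simp only [hxm, hmem a' ha' haX', and_true]
        rcases h with h | h | h
        · exact iff_of_true (h a haX).1 (h x hx).1
        · exact iff_of_true (h a haX).1 (h x hx).1
        · exact iff_of_false (h a haX).2 (h x hx).2
      · rw [hin a' haX', hout a haX]
        have h := hX.2.2 i a ha haX
        simp only [hxm, hmem a ha haX, and_true]
        rcases h with h | h | h
        · exact iff_of_false (h a' haX').2 (h x hx).2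
        · exact iff_of_true (h a' haX').2 (h x hx).2
        · exact iff_of_true (h a' haX').1 (h x hx).1
      · rw [hout a haX, hout a' haX']
        simp [hmem a ha haX, hmem a' ha' haX']
  have key := hq.mem_approval_iff P.cands_nonempty (Finset.insert_nonempty _ _)
  refine ⟨fun c hc hcX => ?_, (key x).trans ⟨?_, ?_⟩⟩
  · refine Iff.trans ⟨fun h => ⟨c, h, hout c hcX⟩, ?_⟩ (key c).symm
    rintro ⟨a, ha, hac⟩
    by_cases haX : a ∈ X
    · rw [hin a haX] at hac
      exact absurd (hac ▸ hx) hcX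
    · rw [hout a haX] at hac
      exact hac ▸ ha
  · rintro ⟨a, ha, hax⟩
    by_cases haX : a ∈ X
    · exact ⟨a, haX, ha⟩
    · rw [hout a haX] at hax
      exact absurd (hax ▸ hx) haX
  · rintro ⟨a, haX, ha⟩
    exact ⟨a, ha, hin a haX⟩

end Voting

/-! ### Profiles given by lists of level functions, and the axioms for them -/

namespace Voting

variable {C : Type*}

/-- The profile over `A` whose ballots are given by a list of level functions. -/
def Profile.ofList (A : Finset C) (hA : A.Nonempty) (L : List (C → ℕ)) : Profile C where
  cands := A
  cands_nonempty := hA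
  n := L.length
  ballot i := WeakOrder.ofLevel A L[i]

theorem Profile.restrict_congr {P : Profile C} {B B' : Finset C} (h : B = B') (hB : B ⊆ P.cands)
    (hB' : B' ⊆ P.cands) (hne : B.Nonempty) (hne' : B'.Nonempty) :
    P.restrict B hB hne = P.restrict B' hB' hne' := by
  subst h
  rfl

theorem Profile.restrict_ofList {A B : Finset C} (hA : A.Nonempty) (hB : B.Nonempty) (hBA : B ⊆ A)
    (L : List (C → ℕ)) : (ofList A hA L).restrict B hBA hB = ofList B hB L := by
  simp only [restrict, ofList, mk.injEq, heq_eq_eq, true_and]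
  funext i
  exact WeakOrder.restrict_ofLevel _ hBA

/-- The score of `c` on the ballot over `A` with level function `g`. -/
noncomputable def ScoringSystem.ballotScore (s : ScoringSystem) (A : Finset C) (g : C → ℕ) (c : C) :
    ℝ :=
  s.score (WeakOrder.ofLevel A g).orderType ((WeakOrder.ofLevel A g).rank c)

/-- The total score of `c` in a list of ballots over `A`. -/
noncomputable def ScoringSystem.total (s : ScoringSystem) (A : Finset C) (L : List (C → ℕ)) (c : C) :
    ℝ :=
  (L.map fun g => s.ballotScore A g c).sum

open Classical in
/-- Indicates whether `c` is on top of the ballot over `A` with level function `g`. -/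
noncomputable def onTop (A : Finset C) (g : C → ℕ) (c : C) : ℕ :=
  if ∀ b ∈ A, g c ≤ g b then 1 else 0

/-- The number of ballots in a list that have `c` on top. -/
noncomputable def onTopCount (A : Finset C) (L : List (C → ℕ)) (c : C) : ℕ :=
  (L.map fun g => onTop A g c).sum

/-- The alternative `w` is among the winners for a list of ballots over `A`. -/
def Elects (s : ScoringSystem) (A : Finset C) (L : List (C → ℕ)) (w : C) : Prop :=
  ∃ hA : A.Nonempty, w ∈ eliminationWinners s (Profile.ofList A hA L)

section Sums

variable (s : ScoringSystem) (A : Finset C) (L L' : List (C → ℕ)) (g : C → ℕ) (c : C)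

theorem ScoringSystem.total_append : s.total A (L ++ L') c = s.total A L c + s.total A L' c := by
  simp [total]

theorem ScoringSystem.total_replicate (k : ℕ) :
    s.total A (List.replicate k g) c = k * s.ballotScore A g c := by
  simp [total]

theorem ScoringSystem.total_flatMap {D : Type*} (X : Finset D) (F : D → List (C → ℕ)) :
    s.total A (X.toList.flatMap F) c = ∑ x ∈ X, s.total A (F x) c := by
  rw [← Finset.sum_map_toList]
  induction X.toList with
  | nil => simp [total]
  | cons x l ih => rw [List.flatMap_cons, total_append, ih, List.map_cons, List.sum_cons]

theorem onTopCount_append : onTopCount A (L ++ L') c = onTopCount A L c + onTopCount A L' c := by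
  simp [onTopCount]

theorem onTopCount_replicate (k : ℕ) :
    onTopCount A (List.replicate k g) c = k * onTop A g c := by
  simp [onTopCount]

theorem onTop_le_one : onTop A g c ≤ 1 := by
  rw [onTop]
  split_ifs <;> omega

theorem onTop_eq_one {A : Finset C} {g : C → ℕ} {c : C} (h : ∀ b ∈ A, g c ≤ g b) :
    onTop A g c = 1 := if_pos h

theorem onTop_eq_zero {A : Finset C} {g : C → ℕ} {b c : C} (hb : b ∈ A) (h : g b < g c) :
    onTop A g c = 0 := if_neg fun h' => absurd (h' b hb) (not_le.2 h)

theorem onTopCount_eq_zero {A : Finset C} {L : List (C → ℕ)} {c : C}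
    (h : ∀ g ∈ L, onTop A g c = 0) : onTopCount A L c = 0 := by
  rw [onTopCount, List.sum_eq_zero_iff]
  intro k hk
  obtain ⟨g, hg, rfl⟩ := List.mem_map.1 hk
  exact h g hg

theorem onTopCount_eq_length {A : Finset C} {L : List (C → ℕ)} {c : C}
    (h : ∀ g ∈ L, onTop A g c = 1) : onTopCount A L c = L.length := by
  rw [onTopCount, List.map_congr_left h]
  simp

end Sums

theorem Profile.score_ofList (s : ScoringSystem) {A : Finset C} (hA : A.Nonempty)
    (L : List (C → ℕ)) (c : C) : (ofList A hA L).score s c = s.total A L c := by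
  rw [score, ScoringSystem.total, ← Fin.sum_univ_fun_getElem]
  rfl

theorem Profile.topCount_ofList {A : Finset C} (hA : A.Nonempty) (L : List (C → ℕ)) {c : C}
    (hc : c ∈ A) : (ofList A hA L).topCount c = onTopCount A L c := by
  classical
  rw [topCount, onTopCount, ← Fin.sum_univ_fun_getElem, Finset.card_filter]
  refine Finset.sum_congr rfl fun i _ => ?_
  rw [onTop]
  exact if_congr (WeakOrder.rank_ofLevel_eq_zero hc) rfl rfl

section Elects

variable {s : ScoringSystem} {A : Finset C} {L : List (C → ℕ)} {w : C}

theorem Elects.mem (h : Elects s A L w) : w ∈ A := by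
  obtain ⟨hA, h⟩ := h
  exact mem_cands_of_mem_eliminationWinners h

theorem exists_elects (s : ScoringSystem) (hA : A.Nonempty) (L : List (C → ℕ)) :
    ∃ w, Elects s A L w := by
  obtain ⟨w, hw⟩ := (eliminationWinners_nonempty_subset s _ (Profile.ofList A hA L) rfl).1
  exact ⟨w, hA, hw⟩

theorem elects_singleton (s : ScoringSystem) (a : C) (L : List (C → ℕ)) : Elects s {a} L a := by
  obtain ⟨w, hw⟩ := exists_elects s (Finset.singleton_nonempty a) L
  have := hw.mem
  rw [Finset.mem_singleton] at this
  exact this ▸ hw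

theorem elects_iff [DecidableEq C] (h : 2 ≤ #A) : Elects s A L w ↔
    ∃ c ∈ A, (∀ d ∈ A, s.total A L c ≤ s.total A L d) ∧ Elects s (A.erase c) L w := by
  have hne : ∀ c, (A.erase c).Nonempty := fun c =>
    Finset.card_pos.1 (by have := Finset.pred_card_le_card_erase (a := c) (s := A); omega)
  have hA : A.Nonempty := Finset.card_pos.1 (by omega)
  have hdel : ∀ c, (Profile.ofList A hA L).delete c h = Profile.ofList (A.erase c) (hne c) L := by
    intro c
    exact (Profile.restrict_congr (by ext; simp [Profile.ofList]) _ _ _ _).trans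
      (Profile.restrict_ofList hA (hne c) (Finset.erase_subset _ _) L)
  have hiff : Elects s A L w ↔ w ∈ eliminationWinners s (Profile.ofList A hA L) :=
    ⟨fun h => h.2, fun h => ⟨hA, h⟩⟩
  rw [hiff, mem_eliminationWinners_iff (P := Profile.ofList A hA L) h]
  refine exists_congr fun c => ?_
  rw [hdel, Profile.lowest, Set.mem_ofPred_eq, and_assoc]
  simp only [Profile.score_ofList]
  exact and_congr_right fun hc => and_congr_right fun _ => ⟨fun h => ⟨hne c, h⟩, fun h => h.2⟩

theorem ScoringSystem.IsApprovalOn.total_le_iff (hs : s.IsApprovalOn A) {c d : C} (hc : c ∈ A)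
    (hd : d ∈ A) : s.total A L c ≤ s.total A L d ↔ onTopCount A L c ≤ onTopCount A L d := by
  have hA : A.Nonempty := ⟨c, hc⟩
  obtain ⟨α, K, hα, h⟩ := (Profile.ofList A hA L).exists_score_eq hs
  rw [← Profile.score_ofList s hA, ← Profile.score_ofList s hA, h c hc, h d hd,
    Profile.topCount_ofList hA L hc, Profile.topCount_ofList hA L hd, sub_le_sub_iff_right,
    mul_le_mul_iff_right₀ hα, Nat.cast_le]

/-- An alternative that is approved by the most voters in every subset is elected. -/
theorem elects_of_onTopCount_le (hs : ∀ B ⊆ A, 2 ≤ #B → s.IsApprovalOn B) (hw : w ∈ A)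
    (hdom : ∀ B ⊆ A, w ∈ B → ∀ b ∈ B, onTopCount B L b ≤ onTopCount B L w) : Elects s A L w := by
  classical
  induction hk : #A using Nat.strong_induction_on generalizing A with
  | _ k ih =>
    by_cases h : 2 ≤ #A
    · have happ := hs A subset_rfl h
      -- A least approved alternative other than `w` is lowest overall even if it ties with `w`;
      -- parallel-universe tie-breaking then lets `w` survive.
      obtain ⟨c, hc, hmin⟩ := (A.erase w).exists_min_image (onTopCount A L)
        (Finset.card_pos.1 (by rw [Finset.card_erase_of_mem hw]; omega))
      rw [Finset.mem_erase] at hc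
      refine (elects_iff h).2 ⟨c, hc.2, fun d hd => (happ.total_le_iff hc.2 hd).2 ?_, ?_⟩
      · by_cases hdw : d = w
        · rw [hdw]
          exact hdom A subset_rfl hw c hc.2
        · exact hmin d (Finset.mem_erase.2 ⟨hdw, hd⟩)
      · have hsub := Finset.erase_subset c A
        exact ih _ (hk ▸ Finset.card_erase_lt_of_mem hc.2) (fun B hB => hs B (hB.trans hsub))
          (Finset.mem_erase.2 ⟨Ne.symm hc.1, hw⟩) (fun B hB => hdom B (hB.trans hsub)) rfl
    · obtain ⟨a, rfl⟩ := Finset.card_eq_one.1 (by have := Finset.card_pos.2 ⟨w, hw⟩; omega : #A = 1)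
      rw [Finset.mem_singleton] at hw
      exact hw ▸ elects_singleton s a L

/-- The majority axiom in the form used below: the voters of `L₁` are the cohesive majority, all
approve `a`, and none approves `w`. -/
theorem not_elects_of_majority (hco : (eliminationRule C s).RespectsCohesiveMajorities)
    {a : C} (ha : a ∈ A) {L₁ L₂ : List (C → ℕ)} (hlen : L₂.length < L₁.length)
    (htop : ∀ g ∈ L₁, (∀ b ∈ A, g a ≤ g b) ∧ ∃ b ∈ A, g b < g w) :
    ¬ Elects s A (L₁ ++ L₂) w := by
  rintro ⟨hA, hw⟩
  set P := Profile.ofList A hA (L₁ ++ L₂) with hP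
  have hlen' : L₁.length ≤ P.n := by simp [hP, Profile.ofList]
  have hmem : ∀ (i : ℕ) (hi : i < (L₁ ++ L₂).length), i < L₁.length → (L₁ ++ L₂)[i] ∈ L₁ := by
    intro i _ hi
    rw [List.getElem_append_left hi]
    exact List.getElem_mem _
  have hcard : #({i : Fin P.n | (i : ℕ) < L₁.length} : Finset (Fin P.n)) = L₁.length := by
    rw [Fin.card_filter_val_lt]
    omega
  have hS := hco P {i : Fin P.n | (i : ℕ) < L₁.length} ?_ ⟨a, ?_⟩ hw
  · obtain ⟨i, hi, hwi⟩ := Set.mem_iUnion₂.1 hS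
    obtain ⟨b, hb, hlt⟩ := (htop _ (hmem i i.2 (Finset.mem_filter.1 hi).2)).2
    exact absurd (hwi.2 b hb).2.2 (not_le.2 hlt)
  · rw [hcard, div_lt_iff₀ two_pos]
    have : P.n = L₁.length + L₂.length := by simp [hP, Profile.ofList]
    rw [this]
    exact_mod_cast (by omega)
  · rw [Set.mem_iInter₂]
    intro i hi
    exact ⟨ha, fun d hd => ⟨ha, hd, (htop _ (hmem i i.2 (Finset.mem_filter.1 hi).2)).1 d hd⟩⟩

/-- The set `X` is a set of clones on the ballot over `A` with level function `g`. -/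
def IsCloneLevel (A X : Finset C) (g : C → ℕ) : Prop :=
  ∀ c ∈ A, c ∉ X → (∀ x ∈ X, g x < g c) ∨ (∀ x ∈ X, g x = g c) ∨ ∀ x ∈ X, g c < g x

theorem isCloneSet_ofList (hA : A.Nonempty) {X : Finset C} {x : C} (hx : x ∈ X) (hX : X ⊆ A)
    (h : ∀ g ∈ L, IsCloneLevel A X g) : (Profile.ofList A hA L).IsCloneSet X := by
  refine ⟨⟨x, hx⟩, hX, fun i c hc hcX => ?_⟩
  have hl := WeakOrder.isLevel_ofLevel A L[i]
  rcases h L[i] (List.getElem_mem _) c hc hcX with h | h | h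
  · exact Or.inl fun y hy => (hl.pref_iff (hX hy) hc).2 (h y hy)
  · exact Or.inr (Or.inl fun y hy => (hl.indiff_iff (hX hy) hc).2 (h y hy))
  · exact Or.inr (Or.inr fun y hy => (hl.pref_iff hc (hX hy)).2 (h y hy))

theorem removeClones_ofList [DecidableEq C] (hA : A.Nonempty) {X : Finset C} {x : C} (hx : x ∈ X)
    (hX : X ⊆ A) : (Profile.ofList A hA L).removeClones X x hX hx =
      Profile.ofList (insert x (A \ X)) (Finset.insert_nonempty _ _) L := by
  exact (Profile.restrict_congr (by ext; simp [Profile.ofList]) _ _ _ _).trans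
    (Profile.restrict_ofList hA (Finset.insert_nonempty x (A \ X))
      (Finset.insert_subset (hX hx) Finset.sdiff_subset) L)

theorem elects_iff_of_notMem_clones [DecidableEq C]
    (hcl : (eliminationRule C s).IndependentOfClones) {X : Finset C} {x : C}
    (hx : x ∈ X) (hX : X ⊆ A) (h : ∀ g ∈ L, IsCloneLevel A X g) (hw : w ∈ A) (hwX : w ∉ X) :
    Elects s A L w ↔ Elects s (insert x (A \ X)) L w := by
  have hA : A.Nonempty := ⟨w, hw⟩
  have := (hcl _ X (isCloneSet_ofList hA hx hX h) x hx).1 w hw hwX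
  rw [removeClones_ofList hA hx hX] at this
  exact ⟨fun h => ⟨_, this.1 h.2⟩, fun h => ⟨_, this.2 h.2⟩⟩

/-- The second clause of clone independence, with the winner itself as the remaining clone. -/
theorem Elects.of_clones [DecidableEq C] (hcl : (eliminationRule C s).IndependentOfClones)
    {X : Finset C} (hX : X ⊆ A) (h : ∀ g ∈ L, IsCloneLevel A X g) (hwX : w ∈ X)
    (hw : Elects s A L w) : Elects s (insert w (A \ X)) L w := by
  have hA : A.Nonempty := ⟨w, hw.mem⟩
  have := (hcl _ X (isCloneSet_ofList hA hwX hX h) w hwX).2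
  rw [removeClones_ofList hA hwX hX] at this
  exact ⟨_, this.2 ⟨w, hwX, hw.2⟩⟩

end Elects

namespace ScoringSystem

variable {s : ScoringSystem} {A : Finset C} {g g' : C → ℕ} {c : C}

theorem ballotScore_nonneg (hc : c ∈ A) : 0 ≤ s.ballotScore A g c :=
  s.nonneg _ (WeakOrder.isOrderType_orderType _ ⟨c, hc⟩) _ (WeakOrder.rank_lt_length _ hc)

theorem ballotScore_congr (h : ∀ a ∈ A, ∀ b ∈ A, g a ≤ g b ↔ g' a ≤ g' b) :
    s.ballotScore A g c = s.ballotScore A g' c := by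
  have : WeakOrder.ofLevel A g = WeakOrder.ofLevel A g' := WeakOrder.ext_rel fun a b =>
    ⟨fun hab => ⟨hab.1, hab.2.1, (h a hab.1 b hab.2.1).1 hab.2.2⟩,
      fun hab => ⟨hab.1, hab.2.1, (h a hab.1 b hab.2.1).2 hab.2.2⟩⟩
  rw [ballotScore, this, ballotScore]

theorem ballotScore_of_onTop (hc : c ∈ A) (h : ∀ b ∈ A, g c ≤ g b) :
    s.ballotScore A g c = s.score (WeakOrder.ofLevel A g).orderType 0 := by
  rw [ballotScore, (WeakOrder.rank_ofLevel_eq_zero hc).2 h]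

/-- The scores on ballots without ties. -/
theorem ballotScore_of_injOn (hg : Set.InjOn g (A : Set C)) (hc : c ∈ A) :
    s.ballotScore A g c = s.score (List.replicate #A 1) #{b ∈ A | g b < g c} := by
  classical
  rw [ballotScore, WeakOrder.orderType_of_injOn (WeakOrder.isLevel_ofLevel A g) hg,
    (WeakOrder.isLevel_ofLevel A g).rank_eq hc, Finset.filter_image, Finset.card_image_of_injOn]
  exact hg.mono fun x hx => (Finset.mem_filter.1 (Finset.mem_coe.1 hx)).1

theorem ballotScore_bottomLevel {d : C} (hd : d ∈ A) (hA : 2 ≤ #A) (hc : c ∈ A) :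
    s.ballotScore A (WeakOrder.bottomLevel d) c =
      s.score [#A - 1, 1] (WeakOrder.bottomLevel d c) := by
  rw [ballotScore, WeakOrder.orderType_bottomLevel hd hA,
    WeakOrder.rank_ofLevel_eq (WeakOrder.image_bottomLevel hd hA) hc]

theorem ballotScore_bottomLevel_self {d : C} (hd : d ∈ A) (hA : 2 ≤ #A) :
    s.ballotScore A (WeakOrder.bottomLevel d) d = 0 := by
  rw [ballotScore_bottomLevel hd hA hd, WeakOrder.bottomLevel, if_pos rfl]
  refine s.last_eq_zero [#A - 1, 1] ⟨by simp, fun k hk => ?_⟩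
  simp only [List.mem_cons, List.not_mem_nil, or_false] at hk
  omega

theorem ballotScore_bottomLevel_of_ne {d : C} (hd : d ∈ A) (hA : 2 ≤ #A) (hc : c ∈ A)
    (hcd : c ≠ d) : s.ballotScore A (WeakOrder.bottomLevel d) c = s.score [#A - 1, 1] 0 := by
  rw [ballotScore_bottomLevel hd hA hc, WeakOrder.bottomLevel, if_neg hcd]

end ScoringSystem

end Voting

/-! ### Strict ballots, ballots with one bottom alternative, and their scores -/

namespace Voting

variable {C : Type*}

section Linear

open Classical in
/-- An enumeration of `A` by the numbers below its cardinality. -/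
noncomputable def enum (A : Finset C) (c : C) : ℕ := if h : c ∈ A then A.equivFin ⟨c, h⟩ else 0

variable {A : Finset C} {p q r c : C}

theorem enum_lt (hc : c ∈ A) : enum A c < #A := by
  rw [enum, dif_pos hc]
  exact (A.equivFin ⟨c, hc⟩).2

theorem enum_injOn (A : Finset C) : Set.InjOn (enum A) (A : Set C) := by
  intro a ha b hb h
  rw [Finset.mem_coe] at ha hb
  rw [enum, enum, dif_pos ha, dif_pos hb] at h
  exact congrArg Subtype.val (A.equivFin.injective (Fin.ext h))

open Classical in
/-- The level function of a ballot over `A` without ties on which `p` is first, `q` is second and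
`r` is last, unless `r` is one of `p` and `q`. -/
noncomputable def linLevel (A : Finset C) (p q r c : C) : ℕ :=
  -- On `A` the enumeration stays below `#A`, so `#A + 2` is worse than every other level.
  if c = p then 0 else if c = q then 1 else if c = r then #A + 2 else enum A c + 2

@[simp]
theorem linLevel_fst : linLevel A p q r p = 0 := if_pos rfl

theorem linLevel_snd (h : q ≠ p) : linLevel A p q r q = 1 := by
  rw [linLevel, if_neg h, if_pos rfl]

theorem linLevel_last (h : r ≠ p) (h' : r ≠ q) : linLevel A p q r r = #A + 2 := by
  rw [linLevel, if_neg h, if_neg h', if_pos rfl]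

theorem one_le_linLevel (h : c ≠ p) : 1 ≤ linLevel A p q r c := by
  rw [linLevel, if_neg h]
  split_ifs <;> omega

theorem two_le_linLevel (h : c ≠ p) (h' : c ≠ q) : 2 ≤ linLevel A p q r c := by
  rw [linLevel, if_neg h, if_neg h']
  split_ifs <;> omega

theorem linLevel_lt (hc : c ∈ A) (h : c ≠ r) : linLevel A p q r c < #A + 2 := by
  have := enum_lt hc
  rw [linLevel]
  split_ifs <;> omega

theorem linLevel_injOn (A : Finset C) (p q r : C) : Set.InjOn (linLevel A p q r) (A : Set C) := by
  intro a ha b hb h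
  have h1 := enum_lt (Finset.mem_coe.1 ha)
  have h2 := enum_lt (Finset.mem_coe.1 hb)
  have h3 := enum_injOn A ha hb
  unfold linLevel at h
  split_ifs at h <;> first | omega | (subst_vars; rfl) | exact h3 (by omega)

/-- Once `p` has been eliminated, the ballot counts for its second choice. -/
theorem onTop_linLevel_snd {B : Finset C} (hp : p ∉ B) (hq : q ∈ B) :
    onTop B (linLevel A p q r) q = 1 :=
  onTop_eq_one fun b hb => by
    rw [linLevel_snd (ne_of_mem_of_not_mem hq hp)]
    exact one_le_linLevel (ne_of_mem_of_not_mem hb hp)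

theorem onTop_linLevel_of_ne {B : Finset C} (hp : p ∉ B) (hq : q ∈ B) (hc : c ∈ B) (h : c ≠ q) :
    onTop B (linLevel A p q r) c = 0 :=
  onTop_eq_zero hq (by
    rw [linLevel_snd (ne_of_mem_of_not_mem hq hp)]
    exact two_le_linLevel (ne_of_mem_of_not_mem hc hp) h)

theorem onTop_linLevel_fst {B : Finset C} : onTop B (linLevel A p q r) p = 1 :=
  onTop_eq_one fun b _ => by simp

theorem onTop_linLevel_of_ne_fst {B : Finset C} (hp : p ∈ B) (h : c ≠ p) :
    onTop B (linLevel A p q r) c = 0 :=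
  onTop_eq_zero hp (by
    rw [linLevel_fst]
    exact one_le_linLevel h)

@[simp]
theorem bottomLevel_self : WeakOrder.bottomLevel p p = 1 := if_pos rfl

theorem bottomLevel_of_ne (h : c ≠ p) : WeakOrder.bottomLevel p c = 0 := if_neg h

theorem onTop_bottomLevel {B : Finset C} (h : c ≠ p) :
    onTop B (WeakOrder.bottomLevel p) c = 1 :=
  onTop_eq_one fun b _ => by
    rw [bottomLevel_of_ne h]
    exact Nat.zero_le _

theorem isCloneLevel_bottomLevel {X : Finset C} (h : p ∉ X) :
    IsCloneLevel A X (WeakOrder.bottomLevel p) := by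
  intro c _ hcX
  by_cases hcp : c = p
  · subst hcp
    refine Or.inl fun x hx => ?_
    rw [bottomLevel_self, bottomLevel_of_ne (ne_of_mem_of_not_mem hx h)]
    exact one_pos
  · refine Or.inr (Or.inl fun x hx => ?_)
    rw [bottomLevel_of_ne hcp, bottomLevel_of_ne (ne_of_mem_of_not_mem hx h)]

end Linear

namespace ScoringSystem

variable (s : ScoringSystem) (m : ℕ)

/-- The score of the alternative at position `j` of a ballot without ties over `m` alternatives. -/
def lin (j : ℕ) : ℝ := s.score (List.replicate m 1) j

/-- The score of all but the bottom alternative on a ballot with a single alternative at the bottom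
and all others tied. -/
def bot : ℝ := s.score [m - 1, 1] 0

variable {s m} {A : Finset C} {g : C → ℕ} {p q r c : C}

theorem isOrderType_replicate (hm : 0 < m) : IsOrderType (List.replicate m 1) :=
  ⟨fun h => by simp at h; omega, fun k hk => by rw [List.eq_of_mem_replicate hk]; exact one_pos⟩

theorem lin_nonneg {j : ℕ} (hj : j < m) : 0 ≤ s.lin m j :=
  s.nonneg _ (isOrderType_replicate (by omega)) j (by simpa)

theorem lin_anti (hmono : s.IsMonotone) {i j : ℕ} (hij : i ≤ j) (hj : j < m) :
    s.lin m j ≤ s.lin m i :=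
  hmono _ (isOrderType_replicate (by omega)) i j hij (by simpa)

theorem lin_last (hm : 0 < m) : s.lin m (m - 1) = 0 := by
  have := s.last_eq_zero _ (isOrderType_replicate hm)
  rwa [List.length_replicate] at this

theorem ballotScore_injOn (hg : Set.InjOn g (A : Set C)) (hc : c ∈ A) :
    s.ballotScore A g c = s.lin #A #{b ∈ A | g b < g c} :=
  ballotScore_of_injOn hg hc

theorem card_filter_lt (hc : c ∈ A) : #{b ∈ A | g b < g c} < #A :=
  Finset.card_lt_card (Finset.filter_ssubset.2 ⟨c, hc, lt_irrefl _⟩)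

theorem ballotScore_injOn_top (hg : Set.InjOn g (A : Set C)) (hc : c ∈ A)
    (h : ∀ b ∈ A, g c ≤ g b) : s.ballotScore A g c = s.lin #A 0 := by
  rw [ballotScore_injOn hg hc, Finset.filter_false_of_mem fun b hb => not_lt.2 (h b hb),
    Finset.card_empty]

theorem ballotScore_injOn_last (hg : Set.InjOn g (A : Set C)) (hc : c ∈ A)
    (h : ∀ b ∈ A, g b ≤ g c) : s.ballotScore A g c = 0 := by
  classical
  have : ({b ∈ A | g b < g c} : Finset C) = A.erase c := by
    ext b
    rw [Finset.mem_filter, Finset.mem_erase, and_comm]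
    refine and_congr_left fun hb => ⟨fun hlt hbc => ?_, fun hne => ?_⟩
    · rw [hbc] at hlt
      exact lt_irrefl _ hlt
    · exact lt_of_le_of_ne (h b hb) fun heq => hne (hg hb hc heq)
  rw [ballotScore_injOn hg hc, this, Finset.card_erase_of_mem hc,
    lin_last (Finset.card_pos.2 ⟨c, hc⟩)]

theorem ballotScore_injOn_of_lt (hmono : s.IsMonotone) (hκ : s.lin #A 1 = 0)
    (hg : Set.InjOn g (A : Set C)) {b : C} (hb : b ∈ A) (hc : c ∈ A) (h : g b < g c) :
    s.ballotScore A g c = 0 := by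
  rw [ballotScore_injOn hg hc]
  have h1 : 1 ≤ #{b ∈ A | g b < g c} :=
    Finset.card_pos.2 ⟨b, Finset.mem_filter.2 ⟨hb, h⟩⟩
  exact le_antisymm ((lin_anti hmono h1 (card_filter_lt hc)).trans hκ.le)
    (lin_nonneg (card_filter_lt hc))

theorem ballotScore_lin_fst (hp : p ∈ A) : s.ballotScore A (linLevel A p q r) p = s.lin #A 0 :=
  ballotScore_injOn_top (linLevel_injOn A p q r) hp fun b _ => by simp

theorem ballotScore_lin_snd (hp : p ∈ A) (hq : q ∈ A) (h : q ≠ p) :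
    s.ballotScore A (linLevel A p q r) q = s.lin #A 1 := by
  rw [ballotScore_injOn (linLevel_injOn A p q r) hq]
  congr 1
  rw [Finset.card_eq_one]
  refine ⟨p, Finset.ext fun b => ?_⟩
  rw [Finset.mem_filter, Finset.mem_singleton, linLevel_snd h]
  constructor
  · rintro ⟨_, hb⟩
    by_contra hne
    have := one_le_linLevel (A := A) (q := q) (r := r) hne
    omega
  · rintro rfl
    exact ⟨hp, by simp⟩

theorem ballotScore_lin_last (hr : r ∈ A) (h : r ≠ p) (h' : r ≠ q) :
    s.ballotScore A (linLevel A p q r) r = 0 :=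
  ballotScore_injOn_last (linLevel_injOn A p q r) hr fun b hb => by
    by_cases hbr : b = r
    · rw [hbr]
    · rw [linLevel_last h h']
      exact (linLevel_lt hb hbr).le

theorem ballotScore_lin_of_ne (hmono : s.IsMonotone) (hκ : s.lin #A 1 = 0) (hp : p ∈ A)
    (hc : c ∈ A) (h : c ≠ p) : s.ballotScore A (linLevel A p q r) c = 0 :=
  ballotScore_injOn_of_lt hmono hκ (linLevel_injOn A p q r) hp hc
    (by rw [linLevel_fst]; exact one_le_linLevel h)

theorem ballotScore_bot_self (hA : 2 ≤ #A) (hp : p ∈ A) :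
    s.ballotScore A (WeakOrder.bottomLevel p) p = 0 :=
  ballotScore_bottomLevel_self hp hA

theorem ballotScore_bot_of_ne (hA : 2 ≤ #A) (hp : p ∈ A) (hc : c ∈ A) (h : c ≠ p) :
    s.ballotScore A (WeakOrder.bottomLevel p) c = s.bot #A :=
  ballotScore_bottomLevel_of_ne hp hA hc h

theorem total_nonneg {L : List (C → ℕ)} (hc : c ∈ A) : 0 ≤ s.total A L c :=
  List.sum_nonneg fun x hx => by
    obtain ⟨g, _, rfl⟩ := List.mem_map.1 hx
    exact ballotScore_nonneg hc

end ScoringSystem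

theorem length_flatMap_replicate {D E : Type*} (X : Finset D) (F : D → E) (N : ℕ) :
    (X.toList.flatMap fun x => List.replicate N (F x)).length = #X * N := by
  simp [List.length_flatMap]

open ScoringSystem WeakOrder

/-! ### First consequences: α > 0, β ≤ α and κ = 0 -/

section Claims

variable {s : ScoringSystem} {A : Finset C} {a d : C}

/-- An alternative that is approved by a majority together cannot be eliminated first if this helps
somebody who is not approved by this majority. -/
theorem not_dominant_of_majority (hco : (eliminationRule C s).RespectsCohesiveMajorities)
    (happ : ∀ B : Finset C, 2 ≤ #B → #B < #A → s.IsApprovalOn B) (ha : a ∈ A) (hd : d ∈ A)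
    (had : d ≠ a) {L₁ L₂ : List (C → ℕ)} (hlen : L₂.length < L₁.length)
    (htop : ∀ g ∈ L₁, (∀ b ∈ A, g a ≤ g b) ∧ g a < g d)
    (hmin : ∀ c ∈ A, s.total A (L₁ ++ L₂) a ≤ s.total A (L₁ ++ L₂) c)
    (hdom : ∀ B ⊆ A, a ∉ B → d ∈ B → ∀ b ∈ B, b ≠ d →
      onTopCount B (L₁ ++ L₂) b ≤ onTopCount B (L₁ ++ L₂) d) : False := by
  classical
  have hA : 2 ≤ #A := Finset.one_lt_card.2 ⟨d, hd, a, ha, had⟩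
  refine not_elects_of_majority hco ha hlen
    (fun g hg => ⟨(htop g hg).1, a, ha, (htop g hg).2⟩)
    ((elects_iff hA).2 ⟨a, ha, hmin, elects_of_onTopCount_le (fun B hB h2 => happ B h2 ?_)
      (Finset.mem_erase.2 ⟨had, hd⟩) fun B hB hdB b hb => ?_⟩)
  · exact (Finset.card_le_card hB).trans_lt (Finset.card_erase_lt_of_mem ha)
  · by_cases hbd : b = d
    · rw [hbd]
    · exact hdom B (hB.trans (Finset.erase_subset _ _))
        (fun h => absurd (hB h) (Finset.notMem_erase _ _)) hdB b hb hbd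

/-- Otherwise monotonicity makes all scores of a strict ballot vanish, and in the profile of one
such ballot its top alternative can go first. -/
theorem lin_zero_pos (hmono : s.IsMonotone)
    (hco : (eliminationRule C s).RespectsCohesiveMajorities) (hA : 2 ≤ #A) : 0 < s.lin #A 0 := by
  classical
  obtain ⟨d, hd⟩ := Finset.card_pos.1 (by omega : 0 < #A)
  by_contra hneg
  have hzero : ∀ j < #A, s.lin #A j = 0 := fun j hj =>
    le_antisymm ((lin_anti hmono (Nat.zero_le j) hj).trans (not_lt.1 hneg)) (lin_nonneg hj)
  have hsc : ∀ c ∈ A, s.total A ([linLevel A d d d] ++ []) c = 0 := by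
    intro c hc
    simp only [List.append_nil, total, List.map_cons, List.map_nil, List.sum_cons, List.sum_nil,
      add_zero]
    rw [ballotScore_injOn (linLevel_injOn A d d d) hc, hzero _ (card_filter_lt hc)]
  obtain ⟨w, hw⟩ := exists_elects s (A := A.erase d)
    (Finset.card_pos.1 (by rw [Finset.card_erase_of_mem hd]; omega)) ([linLevel A d d d] ++ [])
  refine not_elects_of_majority hco hd (L₁ := [linLevel A d d d]) (L₂ := []) (by simp) ?_
    ((elects_iff hA).2 ⟨d, hd, fun c hc => by rw [hsc d hd, hsc c hc], hw⟩)
  intro g hg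
  rw [List.mem_singleton.1 hg]
  refine ⟨fun b _ => by simp, d, hd, ?_⟩
  rw [linLevel_fst]
  exact one_le_linLevel (Finset.ne_of_mem_erase hw.mem)

/-- A majority of one ranks `d` uniquely first, with the second place shared evenly among the
others; all remaining voters put `d` alone at the bottom. If the inequality failed, `d` would be a
lowest scorer in a large enough profile of this kind. -/
theorem bot_add_le_lin (hco : (eliminationRule C s).RespectsCohesiveMajorities)
    (hcl : (eliminationRule C s).IndependentOfClones) (hA : 2 ≤ #A) :
    ((#A - 1 : ℕ) : ℝ) * s.bot #A + s.lin #A 1 ≤ ((#A - 1 : ℕ) : ℝ) * s.lin #A 0 := by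
  classical
  obtain ⟨d, hd⟩ := Finset.card_pos.1 (by omega : 0 < #A)
  have hcard := Finset.card_erase_of_mem hd
  by_contra hlt
  rw [not_le, ← sub_pos] at hlt
  -- `M` is large enough for the accumulated gap to pay for the one missing bottom ballot, which is
  -- worth `s.bot #A`.
  obtain ⟨M, hM⟩ := Archimedean.arch (s.bot #A) hlt
  rw [nsmul_eq_mul] at hM
  obtain ⟨K, hK⟩ : ∃ K, K + 1 = #(A.erase d) * (M + 1) :=
    ⟨#(A.erase d) * (M + 1) - 1, by
      have := Nat.mul_pos (by omega : 0 < #(A.erase d)) (by omega : 0 < M + 1)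
      omega⟩
  set L₁ := (A.erase d).toList.flatMap fun x => List.replicate (M + 1) (linLevel A d x d) with hL₁
  set L₂ := List.replicate K (bottomLevel d) with hL₂
  have hlen : L₂.length < L₁.length := by
    rw [hL₁, length_flatMap_replicate, hL₂, List.length_replicate]
    omega
  have hform : ∀ g ∈ L₁, ∃ x, g = linLevel A d x d := by
    intro g hg
    obtain ⟨x, _, hgx⟩ := List.mem_flatMap.1 hg
    exact ⟨x, List.eq_of_mem_replicate hgx⟩
  have hdlow : ∀ c ∈ A, s.total A (L₁ ++ L₂) d ≤ s.total A (L₁ ++ L₂) c := by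
    intro c hc
    by_cases hcd : c = d
    · rw [hcd]
    have h1 : s.total A (L₁ ++ L₂) d = #(A.erase d) * ((M + 1 : ℕ) * s.lin #A 0) := by
      rw [total_append, hL₁, total_flatMap, hL₂, total_replicate, ballotScore_bot_self hA hd,
        mul_zero, add_zero, ← nsmul_eq_mul, ← Finset.sum_const]
      exact Finset.sum_congr rfl fun x _ => by rw [total_replicate, ballotScore_lin_fst hd]
    have h2 : (M + 1 : ℕ) * s.lin #A 1 + K * s.bot #A ≤ s.total A (L₁ ++ L₂) c := by
      rw [total_append, hL₁, total_flatMap, hL₂, total_replicate, ballotScore_bot_of_ne hA hd hc hcd]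
      refine add_le_add_left ?_ _
      rw [← ballotScore_lin_snd (r := d) hd hc hcd, ← total_replicate]
      exact Finset.single_le_sum (f := fun x => s.total A (List.replicate (M + 1) (linLevel A d x d)) c)
        (fun x _ => total_nonneg hc) (Finset.mem_erase.2 ⟨hcd, hc⟩)
    refine h1.le.trans (le_trans ?_ h2)
    have hK' : (K : ℝ) + 1 = #(A.erase d) * (M + 1) := by exact_mod_cast hK
    rw [← hcard] at hM hlt
    rw [eq_sub_of_add_eq hK']
    push_cast
    linarith
  obtain ⟨w, hw⟩ := exists_elects s (A := A.erase d)
    (Finset.card_pos.1 (by omega)) (L₁ ++ L₂)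
  have hwd := Finset.ne_of_mem_erase hw.mem
  have hwA : Elects s A (L₁ ++ L₂) w := (elects_iff hA).2 ⟨d, hd, hdlow, hw⟩
  -- The alternatives other than `d` are clones, which leaves a contest between `w` and `d` that `d`
  -- wins by majority.
  have hw' := hwA.of_clones hcl (Finset.erase_subset d A) (fun g hg => ?_) hw.mem
  · have hd' : d ∈ insert w (A \ A.erase d) :=
      Finset.mem_insert_of_mem (Finset.mem_sdiff.2 ⟨hd, Finset.notMem_erase _ _⟩)
    refine not_elects_of_majority hco hd' hlen (fun g hg => ?_) hw'
    obtain ⟨x, rfl⟩ := hform g hg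
    refine ⟨fun b _ => by simp, d, hd', ?_⟩
    rw [linLevel_fst]
    exact one_le_linLevel hwd
  · rcases List.mem_append.1 hg with hg | hg
    · obtain ⟨x, rfl⟩ := hform g hg
      intro c hc hcX
      have hcd : c = d := by
        by_contra hne
        exact hcX (Finset.mem_erase.2 ⟨hne, hc⟩)
      subst hcd
      refine Or.inr (Or.inr fun y hy => ?_)
      rw [linLevel_fst]
      exact one_le_linLevel (Finset.ne_of_mem_erase hy)
    · rw [List.eq_of_mem_replicate hg]
      exact isCloneLevel_bottomLevel (Finset.notMem_erase _ _)

theorem bot_le_lin (hco : (eliminationRule C s).RespectsCohesiveMajorities)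
    (hcl : (eliminationRule C s).IndependentOfClones) (hA : 2 ≤ #A) : s.bot #A ≤ s.lin #A 0 := by
  have h := bot_add_le_lin hco hcl hA
  have h1 : 0 ≤ s.lin #A 1 := lin_nonneg (by omega)
  have h2 : (0 : ℝ) < ((#A - 1 : ℕ) : ℝ) := by exact_mod_cast (by omega : 0 < #A - 1)
  by_contra hlt
  nlinarith

/-- If κ > 0, then β < α by `bot_add_le_lin`. Let one voter rank `a` first and `d` second, let `#X *
N` voters put `d` at the bottom, and let equally many rank `d` first and `a` last, sharing the
second place among `X`. The majority approves `a`, but for large `N` it is a lowest scorer; then `d`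
inherits the single ballot and is most approved. -/
theorem lin_one_eq_zero (hco : (eliminationRule C s).RespectsCohesiveMajorities)
    (hcl : (eliminationRule C s).IndependentOfClones)
    (happ : ∀ B : Finset C, 2 ≤ #B → #B < #A → s.IsApprovalOn B) (hA : 3 ≤ #A) :
    s.lin #A 1 = 0 := by
  classical
  obtain ⟨a, ha⟩ := Finset.card_pos.1 (by omega : 0 < #A)
  obtain ⟨d, hd, had⟩ := Finset.exists_mem_ne (by omega : 1 < #A) a
  have h := bot_add_le_lin hco hcl (by omega : 2 ≤ #A)
  have h1 : 0 ≤ s.lin #A 1 := lin_nonneg (by omega)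
  have h2 : (0 : ℝ) < ((#A - 1 : ℕ) : ℝ) := by exact_mod_cast (by omega : 0 < #A - 1)
  by_contra hne
  have hpos : 0 < s.lin #A 1 := lt_of_le_of_ne h1 (Ne.symm hne)
  have hlt : 0 < s.lin #A 0 - s.bot #A := by
    by_contra hle
    nlinarith
  -- The lead of `a` is at most the one strict ballot worth `lin #A 0`. `N₁` outweighs it for the
  -- members of `X`, through second places, and `N₂` for `d`, through α - β.
  obtain ⟨N₁, hN₁⟩ := Archimedean.arch (s.lin #A 0) hpos
  obtain ⟨N₂, hN₂⟩ := Archimedean.arch (s.lin #A 0) hlt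
  rw [nsmul_eq_mul] at hN₁ hN₂
  set N := N₁ + N₂ with hN
  set X := (A.erase a).erase d with hX
  have hXpos : 1 ≤ #X := by
    rw [hX, Finset.card_erase_of_mem (Finset.mem_erase.2 ⟨had, hd⟩), Finset.card_erase_of_mem ha]
    omega
  have hXR : (1 : ℝ) ≤ #X := by exact_mod_cast hXpos
  set L₁ := [linLevel A a d a] ++ List.replicate (#X * N) (bottomLevel d) with hL₁
  set L₂ := X.toList.flatMap fun x => List.replicate N (linLevel A d x a) with hL₂
  have hmem : ∀ c, c ∈ X ↔ c ≠ d ∧ c ≠ a ∧ c ∈ A := fun c => by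
    rw [hX, Finset.mem_erase, Finset.mem_erase]
  have hform : ∀ g ∈ L₂, ∃ x ∈ X, g = linLevel A d x a := by
    intro g hg
    obtain ⟨x, hx, hgx⟩ := List.mem_flatMap.1 hg
    exact ⟨x, Finset.mem_toList.1 hx, List.eq_of_mem_replicate hgx⟩
  have htot : ∀ c, s.total A (L₁ ++ L₂) c = s.ballotScore A (linLevel A a d a) c +
      (#X * N : ℕ) * s.ballotScore A (bottomLevel d) c +
        ∑ x ∈ X, N * s.ballotScore A (linLevel A d x a) c := by
    intro c
    rw [total_append, hL₁, total_append, total_replicate, hL₂, total_flatMap]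
    simp only [total_replicate]
    simp [total]
  have hA2 : 2 ≤ #A := by omega
  refine not_dominant_of_majority hco happ ha hd had (L₁ := L₁) (L₂ := L₂) ?_ ?_ ?_ ?_
  · rw [hL₂, length_flatMap_replicate, hL₁]
    simp
  · intro g hg
    rcases List.mem_append.1 hg with hg | hg
    · rw [List.mem_singleton.1 hg]
      refine ⟨fun b _ => by simp, ?_⟩
      rw [linLevel_fst]
      exact one_le_linLevel had
    · rw [List.eq_of_mem_replicate hg, bottomLevel_self, bottomLevel_of_ne had.symm]
      exact ⟨fun b _ => Nat.zero_le _, one_pos⟩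
  · intro c hc
    by_cases hca : c = a
    · rw [hca]
    have hta : s.total A (L₁ ++ L₂) a = s.lin #A 0 + (#X * N : ℕ) * s.bot #A := by
      rw [htot, ballotScore_lin_fst ha, ballotScore_bot_of_ne hA2 hd ha had.symm,
        Finset.sum_eq_zero, add_zero]
      intro x hx
      rw [ballotScore_lin_last ha had.symm (fun h => ((hmem x).1 hx).2.1 h.symm), mul_zero]
    have hN0 : (0 : ℝ) ≤ N := Nat.cast_nonneg _
    have hN1 : (0 : ℝ) ≤ N₁ := Nat.cast_nonneg _
    have hN2 : (0 : ℝ) ≤ N₂ := Nat.cast_nonneg _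
    have hNc : (N : ℝ) = N₁ + N₂ := by rw [hN]; push_cast; ring
    have h1' := ballotScore_nonneg (s := s) (g := linLevel A a d a) hc
    rw [hta, htot]
    by_cases hcd : c = d
    · subst hcd
      rw [ballotScore_bot_self hA2 hd, Finset.sum_congr rfl fun x _ => by
        rw [ballotScore_lin_fst hd], Finset.sum_const, nsmul_eq_mul]
      push_cast
      have : s.lin #A 0 ≤ N * (s.lin #A 0 - s.bot #A) := by rw [hNc]; nlinarith
      nlinarith [mul_le_mul_of_nonneg_left this (by linarith : (0 : ℝ) ≤ #X),
        lin_nonneg (s := s) (by omega : 0 < #A)]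
    · have hcX : c ∈ X := (hmem c).2 ⟨hcd, hca, hc⟩
      have h3 : N * s.lin #A 1 ≤ ∑ x ∈ X, N * s.ballotScore A (linLevel A d x a) c := by
        rw [← ballotScore_lin_snd (r := a) hd hc hcd]
        exact Finset.single_le_sum (f := fun x => N * s.ballotScore A (linLevel A d x a) c)
          (fun x _ => mul_nonneg hN0 (ballotScore_nonneg hc)) hcX
      rw [ballotScore_bot_of_ne hA2 hd hc hcd]
      have : s.lin #A 0 ≤ N * s.lin #A 1 := by rw [hNc]; nlinarith
      linarith
  · intro B hB haB hdB b hb hbd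
    have hL2 : ∀ c, onTopCount B L₂ c = if c = d then L₂.length else 0 := by
      intro c
      split_ifs with hcd
      · subst hcd
        refine onTopCount_eq_length fun g hg => ?_
        obtain ⟨x, _, rfl⟩ := hform g hg
        exact onTop_linLevel_fst
      · refine onTopCount_eq_zero fun g hg => ?_
        obtain ⟨x, _, rfl⟩ := hform g hg
        exact onTop_linLevel_of_ne_fst hdB hcd
    rw [onTopCount_append B L₁ L₂ b, onTopCount_append B L₁ L₂ d, hL2, hL2, if_neg hbd, if_pos rfl,
      hL₂, length_flatMap_replicate, hL₁, onTopCount_append, onTopCount_append,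
      onTopCount_replicate, onTopCount_replicate]
    have h1 : onTopCount B [linLevel A a d a] b = 0 :=
      onTopCount_eq_zero fun g hg => by
        rw [List.mem_singleton.1 hg, onTop_linLevel_of_ne haB hdB hb hbd]
    have h2 := Nat.mul_le_mul_left (#X * N) (onTop_le_one B (bottomLevel d) b)
    omega

end Claims

end Voting

/-! ### Mixed profiles: other order types, and the comparison of β with α -/

namespace Voting

variable {C : Type*}

open ScoringSystem WeakOrder

section Claims

variable {s : ScoringSystem} {A : Finset C} {a d : C}

/-- The profiles consisting of `y` ballots `a ≻ d ≻ ⋯`, `z` ballots with `d` at the bottom, `k`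
ballots with `a` at the bottom, and some ballots with level function `g`. -/
theorem not_mixed_profile (hmono : s.IsMonotone)
    (hco : (eliminationRule C s).RespectsCohesiveMajorities)
    (happ : ∀ B : Finset C, 2 ≤ #B → #B < #A → s.IsApprovalOn B) (ha : a ∈ A) (hd : d ∈ A)
    (had : d ≠ a) (hκ : s.lin #A 1 = 0) (g : C → ℕ) (y z k N N' : ℕ) (hlen : k + N' < y + z + N)
    (hg : N = 0 ∨ (∀ b ∈ A, g a ≤ g b) ∧ g a < g d)
    (hX : s.lin #A 0 * y + s.bot #A * z + (N + N') * s.ballotScore A g a ≤ s.bot #A * (z + k))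
    (hD : s.lin #A 0 * y + s.bot #A * z + (N + N') * s.ballotScore A g a ≤
      s.bot #A * k + (N + N') * s.ballotScore A g d)
    (hT : ∀ B ⊆ A, a ∉ B → d ∈ B → ∀ b ∈ B, b ≠ d →
      z + (N + N') * onTop B g b ≤ y + (N + N') * onTop B g d) : False := by
  have hA2 : 2 ≤ #A := Finset.one_lt_card.2 ⟨d, hd, a, ha, had⟩
  have h0 : 0 ≤ s.lin #A 0 := lin_nonneg (by omega)
  refine not_dominant_of_majority hco happ ha hd had
    (L₁ := List.replicate y (linLevel A a d a) ++ List.replicate z (bottomLevel d) ++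
      List.replicate N g)
    (L₂ := List.replicate k (bottomLevel a) ++ List.replicate N' g) ?_ ?_ ?_ ?_
  · simp only [List.length_append, List.length_replicate]
    exact hlen
  · intro h hh
    simp only [List.mem_append, List.mem_replicate] at hh
    rcases hh with (⟨-, rfl⟩ | ⟨-, rfl⟩) | ⟨hN, rfl⟩
    · refine ⟨fun b _ => by simp, ?_⟩
      rw [linLevel_fst]
      exact one_le_linLevel had
    · rw [bottomLevel_self, bottomLevel_of_ne had.symm]
      exact ⟨fun b _ => Nat.zero_le _, one_pos⟩
    · exact hg.resolve_left hN
  · intro c hc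
    simp only [total_append, total_replicate]
    rw [ballotScore_lin_fst ha, ballotScore_bot_of_ne hA2 hd ha had.symm, ballotScore_bot_self hA2 ha]
    have hNN : (0 : ℝ) ≤ N + N' := by positivity
    by_cases hcd : c = d
    · subst hcd
      rw [ballotScore_lin_of_ne hmono hκ ha hd had,
        ballotScore_bot_self hA2 hd, ballotScore_bot_of_ne hA2 ha hd had]
      linarith
    by_cases hca : c = a
    · subst hca
      rw [ballotScore_lin_fst ha, ballotScore_bot_of_ne hA2 hd ha had.symm,
        ballotScore_bot_self hA2 ha]
    · have h1 := ballotScore_nonneg (s := s) (g := linLevel A a d a) hc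
      have h2 := mul_nonneg hNN (ballotScore_nonneg (s := s) (g := g) hc)
      rw [ballotScore_bot_of_ne hA2 hd hc hcd, ballotScore_bot_of_ne hA2 ha hc hca]
      nlinarith [mul_nonneg (Nat.cast_nonneg (α := ℝ) y) h1]
  -- Without `a`, the `k` ballots that had it at the bottom approve everybody and cancel.
  · intro B hB haB hdB b hb hbd
    have hba : b ≠ a := ne_of_mem_of_not_mem hb haB
    simp only [onTopCount_append, onTopCount_replicate]
    rw [onTop_linLevel_snd haB hdB, onTop_linLevel_of_ne haB hdB hb hbd, onTop_bottomLevel had,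
      onTop_bottomLevel hbd, onTop_bottomLevel hba]
    have := hT B hB haB hdB b hb hbd
    nlinarith

/-- Once ballots without ties and ballots with a single bottom alternative give the same score to
their top alternatives, all other ballots do as well. -/
theorem isApprovalOn_of_bot_eq_lin (hmono : s.IsMonotone)
    (hco : (eliminationRule C s).RespectsCohesiveMajorities)
    (happ : ∀ B : Finset C, 2 ≤ #B → #B < #A → s.IsApprovalOn B) (hA : 2 ≤ #A)
    (hκ : s.lin #A 1 = 0) (hβ : s.bot #A = s.lin #A 0) : s.IsApprovalOn A := by
  have hα := lin_zero_pos hmono hco hA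
  set α := s.lin #A 0 with hαdef
  -- If the top score of `g` were below α, then `N` such ballots and `N` ballots `a ≻ d ≻ ⋯` would
  -- together give `a` at most α(2N - 1), the amount the `2N - 1` opposing ballots give to everyone
  -- else.
  have lower : ∀ (g : C → ℕ) (a d : C), a ∈ A → d ∈ A → (∀ b ∈ A, g a ≤ g b) → g a < g d →
      α ≤ s.ballotScore A g a := by
    intro g a d ha hd htop hlt
    by_contra hneg
    rw [not_le, ← sub_pos] at hneg
    obtain ⟨N, hN⟩ := Archimedean.arch α hneg
    rw [nsmul_eq_mul] at hN
    have had : d ≠ a := fun h => by rw [h] at hlt; exact lt_irrefl _ hlt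
    have hN0 : 1 ≤ N := by
      by_contra h0
      rw [show N = 0 by omega] at hN
      simp only [Nat.cast_zero, zero_mul] at hN
      linarith
    obtain ⟨k, hk⟩ : ∃ k, k + 1 = N + N := ⟨N + N - 1, by omega⟩
    have hkR : (k : ℝ) = N + N - 1 := by
      rw [eq_sub_iff_add_eq]
      exact_mod_cast hk
    refine not_mixed_profile hmono hco happ ha hd had hκ g N 0 k N 0 (by omega) (Or.inr ⟨htop, hlt⟩)
      ?_ ?_ fun B _ _ _ b _ _ => ?_
    · rw [hβ, ← hαdef, hkR]
      push_cast
      linarith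
    · rw [hβ, ← hαdef, hkR]
      have := mul_nonneg (Nat.cast_nonneg (α := ℝ) N) (ballotScore_nonneg (s := s) (g := g) hd)
      push_cast
      linarith
    · have := Nat.mul_le_mul_left N (onTop_le_one B g b)
      simp only [add_zero, zero_add]
      omega
  -- Here `g` is used by the minority and gives nothing to `a`. Then `a` has α(3N + 2), the same as
  -- what bystanders get from the bottom ballots, and an excess over α on `g` lifts `d` to that
  -- amount.
  have upper : ∀ (g : C → ℕ) (a d : C), a ∈ A → d ∈ A → g d < g a → s.ballotScore A g a = 0 →
      s.ballotScore A g d ≤ α := by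
    intro g a d ha hd hlt hzero
    by_contra hneg
    rw [not_le, ← sub_pos] at hneg
    obtain ⟨N, hN⟩ := Archimedean.arch α hneg
    rw [nsmul_eq_mul] at hN
    have had : d ≠ a := fun h => by rw [h] at hlt; exact lt_irrefl _ hlt
    refine not_mixed_profile hmono hco happ ha hd had hκ g (2 * N + 1) (N + 1) (2 * N + 1) 0 N (by omega)
      (Or.inl rfl) ?_ ?_ fun B _ _ _ b _ _ => ?_
    · rw [hβ, ← hαdef, hzero]
      push_cast
      linarith
    · rw [hβ, ← hαdef, hzero]
      push_cast
      linarith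
    · have := Nat.mul_le_mul_left N (onTop_le_one B g b)
      simp only [zero_add]
      omega
  -- Now `a` has α(2N + 2), matched by the bystanders; `d` has α(2N + 1) from the opposing ballots,
  -- so a positive score on `N` copies of `g` makes up the difference.
  have nontop : ∀ (g : C → ℕ) (a d : C), a ∈ A → d ∈ A → (∀ b ∈ A, g a ≤ g b) → g a < g d →
      s.ballotScore A g a = α → s.ballotScore A g d = 0 := by
    intro g a d ha hd htop hlt hsc
    by_contra hne
    have hpos := lt_of_le_of_ne (ballotScore_nonneg hd) (Ne.symm hne)
    obtain ⟨N, hN⟩ := Archimedean.arch α hpos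
    rw [nsmul_eq_mul] at hN
    have had : d ≠ a := fun h => by rw [h] at hlt; exact lt_irrefl _ hlt
    refine not_mixed_profile hmono hco happ ha hd had hκ g (N + 1) 1 (2 * N + 1) N 0 (by omega)
      (Or.inr ⟨htop, hlt⟩) ?_ ?_ fun B _ _ _ b _ _ => ?_
    · rw [hβ, ← hαdef, hsc]
      push_cast
      linarith
    · rw [hβ, ← hαdef, hsc]
      push_cast
      linarith
    · have := Nat.mul_le_mul_left N (onTop_le_one B g b)
      simp only [add_zero]
      omega
  refine ⟨α, hα, fun R hR c hc => ?_⟩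
  have hsc : ∀ b, s.score R.orderType (R.rank b) = s.ballotScore A R.rank b := fun b => by
    rw [ballotScore, R.ofLevel_rank]
  have htop : ∀ a ∈ A, R.rank a = 0 → s.ballotScore A R.rank a = α := by
    intro a ha ha0
    obtain ⟨d, hd, hd1⟩ := R.exists_rank_eq (show 1 < R.orderType.length by omega)
    -- A member of the last class supplies the alternative of score 0 that `upper` needs.
    obtain ⟨e, he, he1⟩ :=
      R.exists_rank_eq (show R.orderType.length - 1 < R.orderType.length by omega)
    refine le_antisymm (upper _ e a he ha (by omega) ?_)
      (lower _ a d ha hd (fun b _ => by omega) (by omega))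
    rw [← hsc, he1, s.last_eq_zero _ (R.isOrderType_orderType ⟨a, ha⟩)]
  rw [hsc]
  split_ifs with h0
  · exact htop c hc h0
  · obtain ⟨a, ha, ha0⟩ := R.exists_rank_eq (show 0 < R.orderType.length by omega)
    exact nontop _ a c ha hc (fun b _ => by omega) (by omega) (htop a ha ha0)

/-- Take `M + 1` ballots with `d` at the bottom and `M` ballots `d ≻ a ≻ ⋯`. If β < α, then `a` can
go first for large `M`, and by majority the winner `w` is not `d`. All alternatives but `a` and `d`
are clones, so `w` also wins on `{w, a, d}`, where the induction hypothesis applies because `#A ≥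
4`. There `d` must go first, and then `a` beats `w`. -/
theorem lin_le_bot_of_four_le (hmono : s.IsMonotone)
    (hco : (eliminationRule C s).RespectsCohesiveMajorities)
    (hcl : (eliminationRule C s).IndependentOfClones)
    (happ : ∀ B : Finset C, 2 ≤ #B → #B < #A → s.IsApprovalOn B) (hA : 4 ≤ #A)
    (hκ : s.lin #A 1 = 0) : s.lin #A 0 ≤ s.bot #A := by
  classical
  obtain ⟨a, ha⟩ := Finset.card_pos.1 (by omega : 0 < #A)
  obtain ⟨d, hd, had⟩ := Finset.exists_mem_ne (by omega : 1 < #A) a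
  have hA2 : 2 ≤ #A := by omega
  by_contra hlt
  rw [not_le, ← sub_pos] at hlt
  obtain ⟨N, hN⟩ := Archimedean.arch (s.bot #A) hlt
  rw [nsmul_eq_mul] at hN
  set M := N + 1 with hM
  set L₁ := List.replicate (M + 1) (bottomLevel d) with hL₁
  set L₂ := List.replicate M (linLevel A d a d) with hL₂
  have hlen : L₂.length < L₁.length := by simp [hL₁, hL₂]
  have hlow : ∀ c ∈ A, s.total A (L₁ ++ L₂) a ≤ s.total A (L₁ ++ L₂) c := by
    intro c hc
    by_cases hca : c = a
    · rw [hca]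
    rw [total_append, total_append, hL₁, hL₂, total_replicate, total_replicate, total_replicate,
      total_replicate, ballotScore_bot_of_ne hA2 hd ha had.symm,
      ballotScore_lin_of_ne hmono hκ hd ha had.symm]
    by_cases hcd : c = d
    · subst hcd
      rw [ballotScore_bot_self hA2 hd, ballotScore_lin_fst hd, hM]
      push_cast
      linarith
    · rw [ballotScore_bot_of_ne hA2 hd hc hcd, ballotScore_lin_of_ne hmono hκ hd hc hcd]
  have hda : d ∈ A.erase a := Finset.mem_erase.2 ⟨had, hd⟩
  obtain ⟨w, hw⟩ := exists_elects s (A := A.erase a) ⟨d, hda⟩ (L₁ ++ L₂)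
  have hwa := Finset.mem_erase.1 hw.mem
  have hwd : w ≠ d := by
    rintro rfl
    obtain ⟨x, hx, hxd⟩ := Finset.exists_mem_ne
      (by rw [Finset.card_erase_of_mem ha]; omega : 1 < #(A.erase a)) w
    refine not_elects_of_majority hco hx hlen (fun g hg => ?_) hw
    rw [List.eq_of_mem_replicate hg, bottomLevel_of_ne hxd]
    exact ⟨fun b _ => Nat.zero_le _, x, hx, by rw [bottomLevel_of_ne hxd, bottomLevel_self]; omega⟩
  have hwA : Elects s A (L₁ ++ L₂) w := (elects_iff hA2).2 ⟨a, ha, hlow, hw⟩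
  set X := (A.erase a).erase d with hX
  have hmem : ∀ c, c ∈ X ↔ c ≠ d ∧ c ≠ a ∧ c ∈ A := fun c => by
    rw [hX, Finset.mem_erase, Finset.mem_erase]
  have hw' := hwA.of_clones hcl (X := X) (fun c hc => ((hmem c).1 hc).2.2) (fun g hg => ?_)
    ((hmem w).2 ⟨hwd, hwa⟩)
  · have hAX : insert w (A \ X) = {w, a, d} := by
      ext c
      simp only [Finset.mem_insert, Finset.mem_sdiff, hmem, Finset.mem_singleton]
      constructor
      · rintro (rfl | ⟨hc, hc'⟩)
        · exact Or.inl rfl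
        · tauto
      · rintro (rfl | rfl | rfl)
        · exact Or.inl rfl
        · exact Or.inr ⟨ha, by tauto⟩
        · exact Or.inr ⟨hd, by tauto⟩
    rw [hAX] at hw'
    have hcard : #({w, a, d} : Finset C) = 3 := Finset.card_eq_three.2
      ⟨w, a, d, hwa.1, hwd, had.symm, rfl⟩
    set T : Finset C := {w, a, d} with hT
    have hdT : d ∈ T := by simp [hT]
    obtain ⟨c, hcT, hc, hwc⟩ := (elects_iff (by omega : 2 ≤ #T)).1 hw'
    have happT := happ T (by omega) (by omega)
    have hcd : c = d := by
      by_contra hcd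
      have hle := (happT.total_le_iff hcT hdT).1 (hc d hdT)
      rw [onTopCount_append, onTopCount_append, hL₁, hL₂, onTopCount_replicate, onTopCount_replicate,
        onTopCount_replicate, onTopCount_replicate, onTop_bottomLevel hcd,
        onTop_linLevel_of_ne_fst hdT hcd, onTop_linLevel_fst,
        onTop_eq_zero (b := a) (by simp [hT]) (by
          rw [bottomLevel_of_ne had.symm, bottomLevel_self]
          exact one_pos)] at hle
      omega
    subst hcd
    have hcardT : #(T.erase c) = 2 := by rw [Finset.card_erase_of_mem hdT, hcard]
    have haT : a ∈ T.erase c := Finset.mem_erase.2 ⟨had.symm, by simp [hT]⟩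
    obtain ⟨e, heT, he, hwe⟩ := (elects_iff (by omega : 2 ≤ #(T.erase c))).1 hwc
    have hwe' := (Finset.mem_erase.1 hwe.mem).1
    have hea : e = a := by
      have : e ∈ T.erase c := heT
      rw [Finset.mem_erase, hT] at this
      simp only [Finset.mem_insert, Finset.mem_singleton] at this
      rcases this with ⟨h1, h2 | h2 | h2⟩
      · exact absurd h2.symm hwe'
      · exact h2
      · exact absurd h2 h1
    subst hea
    have hle := ((happ _ (by omega) (by omega)).total_le_iff haT hwc.mem).1 (he w hwc.mem)
    have hcT' : c ∉ T.erase c := Finset.notMem_erase _ _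
    rw [onTopCount_append, onTopCount_append, hL₁, hL₂, onTopCount_replicate, onTopCount_replicate,
      onTopCount_replicate, onTopCount_replicate, onTop_bottomLevel had.symm,
      onTop_bottomLevel hwd, onTop_linLevel_snd hcT' haT,
      onTop_linLevel_of_ne hcT' haT hwc.mem hwe'] at hle
    omega
  · rcases List.mem_append.1 hg with hg | hg
    · rw [List.eq_of_mem_replicate hg]
      exact isCloneLevel_bottomLevel fun h => ((hmem d).1 h).1 rfl
    · rw [List.eq_of_mem_replicate hg]
      intro c hc hcX
      refine Or.inr (Or.inr fun x hx => ?_)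
      rw [hmem] at hx hcX
      have h2 := two_le_linLevel (A := A) (r := d) hx.1 hx.2.1
      by_cases hcd : c = d
      · rw [hcd, linLevel_fst]
        omega
      · have hca : c = a := by tauto
        rw [hca, linLevel_snd had.symm]
        omega

/-- For three alternatives, the score of a tie at the top is not strictly between one half of the
score of a unique top alternative and that score. -/
theorem two_mul_bot_le_lin_of_lt (hmono : s.IsMonotone)
    (hco : (eliminationRule C s).RespectsCohesiveMajorities)
    (happ : ∀ B : Finset C, 2 ≤ #B → #B < #A → s.IsApprovalOn B) (hA : 2 ≤ #A)
    (hκ : s.lin #A 1 = 0) (hlt : s.bot #A < s.lin #A 0) : 2 * s.bot #A ≤ s.lin #A 0 := by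
  classical
  obtain ⟨a, ha⟩ := Finset.card_pos.1 (by omega : 0 < #A)
  obtain ⟨d, hd, had⟩ := Finset.exists_mem_ne (by omega : 1 < #A) a
  by_contra hneg
  rw [not_le, ← sub_pos] at hneg
  rw [← sub_pos] at hlt
  -- `j` ensures α(j + 1) ≤ β(2j + 1), which keeps `a` no higher than the bystanders; `M`, chosen
  -- afterwards, lifts `d` through the `M` ballots that rank it first.
  obtain ⟨j, hj⟩ := Archimedean.arch (s.bot #A) hneg
  obtain ⟨M, hM⟩ := Archimedean.arch ((j + 1 : ℕ) * s.bot #A) hlt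
  rw [nsmul_eq_mul] at hj hM
  push_cast at hM
  refine not_mixed_profile hmono hco happ ha hd had hκ (linLevel A d a d) (j + 1) (M + (j + 1))
    (2 * j + 1) 0 M (by omega) (Or.inl rfl) ?_ ?_ fun B _ _ hdB b _ hbd => ?_
  · rw [ballotScore_lin_of_ne hmono hκ hd ha had.symm]
    push_cast
    linarith
  · rw [ballotScore_lin_of_ne hmono hκ hd ha had.symm, ballotScore_lin_fst hd]
    push_cast
    linarith
  · rw [onTop_linLevel_fst, onTop_linLevel_of_ne_fst hdB hbd]
    omega

end Claims

end Voting

/-! ### Four alternatives: refuting 2β ≤ α on three -/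

namespace Voting

variable {C : Type*}

open ScoringSystem WeakOrder

theorem ScoringSystem.ballotScore_of_last {s : ScoringSystem} {A : Finset C} {g : C → ℕ} {c : C}
    (hc : c ∈ A) (h : ∀ b ∈ A, g b ≤ g c) : s.ballotScore A g c = 0 := by
  set R := ofLevel A g
  have hlt := R.rank_lt_length hc
  obtain ⟨e, he, her⟩ :=
    R.exists_rank_eq (show R.orderType.length - 1 < R.orderType.length by omega)
  have := (R.isLevel_rank e he c hc).1 ((isLevel_ofLevel A g e he c hc).2 (h e he))
  rw [ballotScore, show R.rank c = R.orderType.length - 1 by omega]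
  exact s.last_eq_zero _ (R.isOrderType_orderType ⟨c, hc⟩)

open Classical in
/-- The level function of a ballot over four alternatives with `p` and `q` tied at the top and `r`
in third position. -/
noncomputable def tieLevel (p q r c : C) : ℕ := if c = p ∨ c = q then 0 else if c = r then 1 else 2

theorem orderType_tieLevel {A : Finset C} {p q r t : C} (hA : ∀ x, x ∈ A ↔ x = p ∨ x = q ∨ x = r ∨ x = t)
    (hpq : p ≠ q) (hpr : p ≠ r) (hpt : p ≠ t) (hqr : q ≠ r) (hqt : q ≠ t) (hrt : r ≠ t) :
    (ofLevel A (tieLevel p q r)).orderType = [2, 1, 1] := by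
  classical
  have hval : ∀ x ∈ A, (x = p ∨ x = q) ∧ tieLevel p q r x = 0 ∨ x = r ∧ tieLevel p q r x = 1 ∨
      x = t ∧ tieLevel p q r x = 2 := by
    intro x hx
    rcases (hA x).1 hx with rfl | rfl | rfl | rfl
    · simp [tieLevel]
    · simp [tieLevel]
    · simp [tieLevel, hpr.symm, hqr.symm]
    · simp [tieLevel, hpt.symm, hqt.symm, hrt.symm]
  have himg : A.image (tieLevel p q r) = Finset.range 3 := by
    ext j
    rw [Finset.mem_image, Finset.mem_range]
    constructor
    · rintro ⟨x, hx, rfl⟩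
      rcases hval x hx with ⟨_, h⟩ | ⟨_, h⟩ | ⟨_, h⟩ <;> omega
    · intro hj
      interval_cases j
      · exact ⟨p, (hA p).2 (by simp), by simp [tieLevel]⟩
      · exact ⟨r, (hA r).2 (by simp), by simp [tieLevel, hpr.symm, hqr.symm]⟩
      · exact ⟨t, (hA t).2 (by simp), by simp [tieLevel, hpt.symm, hqt.symm, hrt.symm]⟩
  have hr : ∀ x ∈ A, (ofLevel A (tieLevel p q r)).rank x = tieLevel p q r x := fun x hx =>
    rank_ofLevel_eq himg hx
  have h0 : ({x ∈ A | (ofLevel A (tieLevel p q r)).rank x = 0} : Finset C) = {p, q} := by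
    ext x
    rw [Finset.mem_filter, Finset.mem_insert, Finset.mem_singleton]
    constructor
    · rintro ⟨hx, h⟩
      rw [hr x hx] at h
      rcases hval x hx with ⟨h', _⟩ | ⟨_, h'⟩ | ⟨_, h'⟩
      · exact h'
      · omega
      · omega
    · intro h
      have hx : x ∈ A := (hA x).2 (by tauto)
      exact ⟨hx, by rw [hr x hx]; exact if_pos h⟩
  have h1 : ({x ∈ A | (ofLevel A (tieLevel p q r)).rank x = 1} : Finset C) = {r} := by
    ext x
    rw [Finset.mem_filter, Finset.mem_singleton]
    constructor
    · rintro ⟨hx, h⟩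
      rw [hr x hx] at h
      rcases hval x hx with ⟨_, h'⟩ | ⟨h', _⟩ | ⟨_, h'⟩
      · omega
      · exact h'
      · omega
    · rintro rfl
      have hx : x ∈ A := (hA x).2 (by tauto)
      exact ⟨hx, by rw [hr x hx]; simp [tieLevel, hpr.symm, hqr.symm]⟩
  have h2 : ({x ∈ A | (ofLevel A (tieLevel p q r)).rank x = 2} : Finset C) = {t} := by
    ext x
    rw [Finset.mem_filter, Finset.mem_singleton]
    constructor
    · rintro ⟨hx, h⟩
      rw [hr x hx] at h
      rcases hval x hx with ⟨_, h'⟩ | ⟨_, h'⟩ | ⟨h', _⟩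
      · omega
      · omega
      · exact h'
    · rintro rfl
      have hx : x ∈ A := (hA x).2 (by tauto)
      exact ⟨hx, by rw [hr x hx]; simp [tieLevel, hpt.symm, hqt.symm, hrt.symm]⟩
  rw [orderType_eq_map, ← length_orderType, (isLevel_ofLevel A _).length_orderType, himg,
    Finset.card_range]
  simp [List.range_succ, h0, h1, h2, Finset.card_pair hpq]

theorem IsCloneLevel.mono {A A' X : Finset C} {g : C → ℕ} (h : IsCloneLevel A X g) (hA : A' ⊆ A) :
    IsCloneLevel A' X g := fun c hc => h c (hA hc)

section FourAlternatives

variable {s : ScoringSystem} {a b c d : C}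

/-- Otherwise `b` can go first in a profile where `c` and `d` are clones, and then `a` beats them 11
to 8. Dropping the clone `d` beforehand must keep `a` a winner, but on `{a, b, c}` it is the unique
lowest scorer, since 2β ≤ α gives 7β < 4α there. -/
theorem seven_mul_bot_lt [DecidableEq C] (hmono : s.IsMonotone)
    (hcl : (eliminationRule C s).IndependentOfClones)
    (happ : ∀ B : Finset C, #B = 2 → s.IsApprovalOn B) (hκ : s.lin 3 1 = 0) (hα : 0 < s.lin 3 0)
    (hβ : 2 * s.bot 3 ≤ s.lin 3 0) (hab : a ≠ b) (hac : a ≠ c) (had : a ≠ d) (hbc : b ≠ c)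
    (hbd : b ≠ d) (hcd : c ≠ d) : 7 * s.bot 4 < 4 * s.lin 4 0 := by
  set A : Finset C := {a, b, c, d} with hA
  have hmem : ∀ x, x ∈ A ↔ x = a ∨ x = b ∨ x = c ∨ x = d := fun x => by simp [hA]
  have hcard : #A = 4 := Finset.card_eq_succ.2 ⟨a, {b, c, d}, by simp [hab, hac, had], rfl,
    Finset.card_eq_three.2 ⟨b, c, d, hbc, hbd, hcd, rfl⟩⟩
  have ha : a ∈ A := by simp [hA]
  have hb : b ∈ A := by simp [hA]
  have hA2 : 2 ≤ #A := by omega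
  by_contra hneg
  rw [not_lt] at hneg
  set L := List.replicate 7 (bottomLevel b) ++ List.replicate 4 (linLevel A b a b) ++
    List.replicate 1 (linLevel A c d b) with hL
  have hcount : ∀ (B : Finset C) (x : C), onTopCount B L x = 7 * onTop B (bottomLevel b) x +
      4 * onTop B (linLevel A b a b) x + 1 * onTop B (linLevel A c d b) x := fun B x => by
    rw [hL, onTopCount_append, onTopCount_append, onTopCount_replicate, onTopCount_replicate,
      onTopCount_replicate]
  have htot : ∀ (B : Finset C) (x : C), s.total B L x = 7 * s.ballotScore B (bottomLevel b) x +
      4 * s.ballotScore B (linLevel A b a b) x + s.ballotScore B (linLevel A c d b) x := by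
    intro B x
    rw [hL, total_append, total_append, total_replicate, total_replicate, total_replicate]
    push_cast
    ring
  have hclone : ∀ g ∈ L, IsCloneLevel A {c, d} g := by
    intro g hg
    rw [hL, List.mem_append, List.mem_append, List.mem_replicate, List.mem_replicate,
      List.mem_replicate] at hg
    rcases hg with (⟨-, rfl⟩ | ⟨-, rfl⟩) | ⟨-, rfl⟩
    · exact isCloneLevel_bottomLevel (by simp [hbc, hbd])
    · intro x hx hxX
      refine Or.inr (Or.inr fun y hy => ?_)
      have hy2 : 2 ≤ linLevel A b a b y := by
        rcases Finset.mem_insert.1 hy with rfl | hy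
        · exact two_le_linLevel hbc.symm hac.symm
        · rw [Finset.mem_singleton.1 hy]
          exact two_le_linLevel hbd.symm had.symm
      rw [hmem] at hx
      simp only [Finset.mem_insert, Finset.mem_singleton, not_or] at hxX
      rcases hx with rfl | rfl | rfl | rfl
      · rw [linLevel_snd hab]
        omega
      · rw [linLevel_fst]
        omega
      · exact absurd rfl hxX.1
      · exact absurd rfl hxX.2
    · intro x hx hxX
      simp only [Finset.mem_insert, Finset.mem_singleton, not_or] at hxX
      have hx2 := two_le_linLevel (A := A) (r := b) hxX.1 hxX.2
      refine Or.inl fun y hy => ?_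
      rcases Finset.mem_insert.1 hy with rfl | hy
      · rw [linLevel_fst]
        omega
      · rw [Finset.mem_singleton.1 hy, linLevel_snd hcd.symm]
        omega
  have hXA : ({c, d} : Finset C) ⊆ A := by
    intro x
    simp [hA]
    tauto
  have hcX : c ∈ ({c, d} : Finset C) := by simp
  have haX : a ∉ ({c, d} : Finset C) := by simp [hac, had]
  -- after the elimination of `b`, the alternative `a` beats the clones `c` and `d`
  have hel2 : Elects s {c, a} L a := by
    refine elects_of_onTopCount_le (fun B hB h2 => happ B ?_) (by simp) fun B hB haB x hx => ?_
    · have := Finset.card_le_card hB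
      rw [Finset.card_pair hac.symm] at this
      omega
    · by_cases hxa : x = a
      · rw [hxa]
      have hbB : b ∉ B := fun h => by
        have := hB h
        simp [hab.symm, hbc] at this
      rw [hcount, hcount, onTop_linLevel_snd hbB haB, onTop_linLevel_of_ne hbB haB hx hxa,
        onTop_bottomLevel hab, onTop_bottomLevel (ne_of_mem_of_not_mem hx hbB)]
      have := onTop_le_one B (linLevel A c d b) x
      omega
  have hsub : A.erase b ⊆ A := Finset.erase_subset _ _
  have hel3 : Elects s (A.erase b) L a := by
    refine (elects_iff_of_notMem_clones hcl hcX (fun x hx => ?_) (fun g hg => (hclone g hg).mono hsub)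
      (Finset.mem_erase.2 ⟨hab, ha⟩) haX).2 ?_
    · refine Finset.mem_erase.2 ⟨?_, hXA hx⟩
      rintro rfl
      simp [hbc, hbd] at hx
    · convert hel2 using 1
      ext x
      simp only [Finset.mem_insert, Finset.mem_sdiff, Finset.mem_erase, hmem, Finset.mem_singleton]
      grind
  have hel4 : Elects s A L a := by
    refine (elects_iff hA2).2 ⟨b, hb, fun x hx => ?_, hel3⟩
    by_cases hxb : x = b
    · rw [hxb]
    rw [htot, htot, ballotScore_bot_self hA2 hb, ballotScore_lin_fst hb,
      ballotScore_lin_last hb hbc hbd, ballotScore_bot_of_ne hA2 hb hx hxb, hcard]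
    have h1 := ballotScore_nonneg (s := s) (g := linLevel A b a b) hx
    have h2 := ballotScore_nonneg (s := s) (g := linLevel A c d b) hx
    linarith
  -- but without the clone `d`, the alternative `a` is eliminated first
  have hel3' := (elects_iff_of_notMem_clones hcl hcX hXA hclone ha haX).1 hel4
  set T := insert c (A \ {c, d}) with hT
  have hTmem : ∀ x, x ∈ T ↔ x = a ∨ x = b ∨ x = c := by
    intro x
    simp only [hT, Finset.mem_insert, Finset.mem_sdiff, hmem, Finset.mem_singleton]
    grind
  have hTA : T ⊆ A := fun x hx => by
    rw [hTmem] at hx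
    rw [hmem]
    tauto
  have hTcard : #T = 3 := Finset.card_eq_three.2 ⟨a, b, c, hab, hac, hbc, by
    ext x
    simp [hTmem]⟩
  have hT2 : 2 ≤ #T := by omega
  have haT : a ∈ T := (hTmem a).2 (by simp)
  have hbT : b ∈ T := (hTmem b).2 (by simp)
  have hcT : c ∈ T := (hTmem c).2 (by simp)
  have hinj : ∀ p q, Set.InjOn (linLevel A p q b) (T : Set C) := fun p q =>
    (linLevel_injOn A p q b).mono (by exact_mod_cast hTA)
  have hκ' : s.lin #T 1 = 0 := by rw [hTcard, hκ]
  have hta : s.total T L a = 7 * s.bot 3 := by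
    rw [htot, ballotScore_bot_of_ne hT2 hbT haT hab,
      ballotScore_injOn_of_lt hmono hκ' (hinj b a) hbT haT
        (by rw [linLevel_fst]; exact one_le_linLevel hab),
      ballotScore_injOn_of_lt hmono hκ' (hinj c d) hcT haT
        (by rw [linLevel_fst]; exact one_le_linLevel hac), hTcard]
    ring
  have htb : s.total T L b = 4 * s.lin 3 0 := by
    rw [htot, ballotScore_bot_self hT2 hbT,
      ballotScore_injOn_top (hinj b a) hbT (fun x _ => by simp),
      ballotScore_injOn_of_lt hmono hκ' (hinj c d) hcT hbT
        (by rw [linLevel_fst]; exact one_le_linLevel hbc), hTcard]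
    ring
  have htc : s.total T L c = 7 * s.bot 3 + s.lin 3 0 := by
    rw [htot, ballotScore_bot_of_ne hT2 hbT hcT hbc.symm,
      ballotScore_injOn_of_lt hmono hκ' (hinj b a) hbT hcT
        (by rw [linLevel_fst]; exact one_le_linLevel hbc.symm),
      ballotScore_injOn_top (hinj c d) hcT (fun x _ => by simp), hTcard]
    ring
  obtain ⟨e, he, hlow, hel⟩ := (elects_iff hT2).1 hel3'
  have hlow := hlow a haT
  rcases (hTmem e).1 he with rfl | rfl | rfl
  · exact absurd hel.mem (Finset.notMem_erase _ _)
  · linarith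
  · linarith

set_option maxHeartbeats 1000000 in
-- Five of nine voters approve `a` and not `d`. If 2β ≤ α on three alternatives, then `a`, `b`, `c`
-- can be eliminated in this order, so `d` is elected. Nothing is known yet about scores on four
-- alternatives except `seven_mul_bot_lt`.
theorem lin_three_lt_two_mul_bot [DecidableEq C] (hmono : s.IsMonotone)
    (hco : (eliminationRule C s).RespectsCohesiveMajorities)
    (hcl : (eliminationRule C s).IndependentOfClones)
    (happ : ∀ B : Finset C, #B = 2 → s.IsApprovalOn B) (hκ : s.lin 3 1 = 0) (hα : 0 < s.lin 3 0)
    (hab : a ≠ b) (hac : a ≠ c) (had : a ≠ d) (hbc : b ≠ c)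
    (hbd : b ≠ d) (hcd : c ≠ d) : s.lin 3 0 < 2 * s.bot 3 := by
  by_contra hβ
  rw [not_lt] at hβ
  have h7 := seven_mul_bot_lt hmono hcl happ hκ hα hβ hab hac had hbc hbd hcd
  set A : Finset C := {a, b, c, d} with hA
  have hmem : ∀ x, x ∈ A ↔ x = a ∨ x = b ∨ x = c ∨ x = d := fun x => by simp [hA]
  have hcard : #A = 4 := Finset.card_eq_succ.2 ⟨a, {b, c, d}, by simp [hab, hac, had], rfl,
    Finset.card_eq_three.2 ⟨b, c, d, hbc, hbd, hcd, rfl⟩⟩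
  have ha : a ∈ A := by simp [hA]
  have hb : b ∈ A := by simp [hA]
  have hc : c ∈ A := by simp [hA]
  have hd : d ∈ A := by simp [hA]
  have hA2 : 2 ≤ #A := by omega
  -- Without `a`, the ties in `L₁` become the strict ballots `b ≻ d ≻ c` and `c ≻ b ≻ d`, while
  -- those in `L₂` become ballots with one bottom alternative.
  set L₁ := [tieLevel a b d, tieLevel a c b, bottomLevel d, bottomLevel d, bottomLevel d] with hL₁
  set L₂ := [linLevel A d b a, linLevel A d c a, tieLevel b d c, tieLevel c d b] with hL₂
  have htot : ∀ (B : Finset C) (x : C), s.total B (L₁ ++ L₂) x =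
      s.ballotScore B (tieLevel a b d) x + s.ballotScore B (tieLevel a c b) x +
      3 * s.ballotScore B (bottomLevel d) x + s.ballotScore B (linLevel A d b a) x +
      s.ballotScore B (linLevel A d c a) x + s.ballotScore B (tieLevel b d c) x +
      s.ballotScore B (tieLevel c d b) x := by
    intro B x
    simp only [total, hL₁, hL₂, List.cons_append, List.nil_append, List.map_cons, List.map_nil,
      List.sum_cons, List.sum_nil]
    ring
  have hcount : ∀ (B : Finset C) (x : C), onTopCount B (L₁ ++ L₂) x =
      onTop B (tieLevel a b d) x + onTop B (tieLevel a c b) x +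
      3 * onTop B (bottomLevel d) x + onTop B (linLevel A d b a) x +
      onTop B (linLevel A d c a) x + onTop B (tieLevel b d c) x + onTop B (tieLevel c d b) x := by
    intro B x
    simp only [onTopCount, hL₁, hL₂, List.cons_append, List.nil_append, List.map_cons, List.map_nil,
      List.sum_cons, List.sum_nil]
    ring
  have htie0 : ∀ p q r : C, tieLevel p q r p = 0 ∧ tieLevel p q r q = 0 := fun p q r => by
    simp [tieLevel]
  have htie1 : ∀ p q r : C, r ≠ p → r ≠ q → tieLevel p q r r = 1 := fun p q r h h' => by
    simp [tieLevel, h, h']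
  have htie2 : ∀ p q r t : C, t ≠ p → t ≠ q → t ≠ r → tieLevel p q r t = 2 := fun p q r t h h' h'' => by
    simp [tieLevel, h, h', h'']
  -- Each alternative is in exactly two of the four top ties, so the unknown score `s.score [2, 1,
  -- 1] 0` cancels from the comparison with `a`.
  have htop : ∀ p q r x : C, x ∈ A → (x = p ∨ x = q) →
      (ofLevel A (tieLevel p q r)).orderType = [2, 1, 1] →
      s.ballotScore A (tieLevel p q r) x = s.score [2, 1, 1] 0 := by
    intro p q r x hx hpq ht
    have h0 : tieLevel p q r x = 0 := if_pos hpq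
    rw [ballotScore_of_onTop hx fun y _ => by rw [h0]; exact Nat.zero_le _, ht]
  have ht1 : (ofLevel A (tieLevel a b d)).orderType = [2, 1, 1] :=
    orderType_tieLevel (t := c) (fun x => by rw [hmem]; tauto) hab had hac hbd hbc hcd.symm
  have ht2 : (ofLevel A (tieLevel a c b)).orderType = [2, 1, 1] :=
    orderType_tieLevel (t := d) (fun x => by rw [hmem]; tauto) hac hab had hbc.symm hcd hbd
  have ht3 : (ofLevel A (tieLevel b d c)).orderType = [2, 1, 1] :=
    orderType_tieLevel (t := a) (fun x => by rw [hmem]; tauto) hbd hbc hab.symm hcd.symm had.symm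
      hac.symm
  have ht4 : (ofLevel A (tieLevel c d b)).orderType = [2, 1, 1] :=
    orderType_tieLevel (t := a) (fun x => by rw [hmem]; tauto) hcd hbc.symm hac.symm hbd.symm had.symm
      hab.symm
  have hle2 : ∀ p q r x : C, tieLevel p q r x ≤ 2 := fun p q r x => by
    unfold tieLevel
    split_ifs <;> omega
  have hlast : ∀ p q r : C, a ≠ p → a ≠ q → a ≠ r → s.ballotScore A (tieLevel p q r) a = 0 :=
    fun p q r h h' h'' => ballotScore_of_last ha fun x _ => by
      rw [htie2 p q r a h h' h'']
      exact hle2 p q r x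
  -- `a` is eliminated first
  have hla : ∀ x ∈ A, s.total A (L₁ ++ L₂) a ≤ s.total A (L₁ ++ L₂) x := by
    intro x hx
    have hn : ∀ g, 0 ≤ s.ballotScore A g x := fun g => ballotScore_nonneg hx
    rw [htot, htot, htop a b d a ha (Or.inl rfl) ht1, htop a c b a ha (Or.inl rfl) ht2,
      ballotScore_bot_of_ne hA2 hd ha had, ballotScore_lin_last ha had hab,
      ballotScore_lin_last ha had hac, hlast b d c hab had hac, hlast c d b hac had hab]
    have hn1 := hn (tieLevel a b d)
    have hn2 := hn (tieLevel a c b)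
    have hn4 := hn (linLevel A d b a)
    have hn5 := hn (linLevel A d c a)
    have hn6 := hn (tieLevel b d c)
    have hn7 := hn (tieLevel c d b)
    rcases (hmem x).1 hx with rfl | rfl | rfl | rfl
    · rw [htop x b d x ha (Or.inl rfl) ht1, htop x c b x ha (Or.inl rfl) ht2,
        ballotScore_bot_of_ne hA2 hd ha had]
      linarith
    · rw [htop a x d x hx (Or.inr rfl) ht1, htop x d c x hx (Or.inl rfl) ht3,
        ballotScore_bot_of_ne hA2 hd hx hbd]
      linarith
    · rw [htop a x b x hx (Or.inr rfl) ht2, htop x d b x hx (Or.inl rfl) ht4,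
        ballotScore_bot_of_ne hA2 hd hx hcd]
      linarith
    · rw [htop b x c x hx (Or.inr rfl) ht3, htop c x b x hx (Or.inr rfl) ht4,
        ballotScore_bot_self hA2 hd, ballotScore_lin_fst hd, ballotScore_lin_fst hd, hcard]
      have h4 : 0 ≤ s.lin 4 0 := lin_nonneg (by omega)
      linarith
  set T := A.erase a with hT
  have hTmem : ∀ x, x ∈ T ↔ x = b ∨ x = c ∨ x = d := by
    intro x
    rw [hT, Finset.mem_erase, hmem]
    grind
  have hTA : T ⊆ A := Finset.erase_subset _ _
  have hTcard : #T = 3 := by rw [hT, Finset.card_erase_of_mem ha, hcard]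
  have hT2 : 2 ≤ #T := by omega
  have hbT : b ∈ T := (hTmem b).2 (by simp)
  have hcT : c ∈ T := (hTmem c).2 (by simp)
  have hdT : d ∈ T := (hTmem d).2 (by simp)
  have hκ' : s.lin #T 1 = 0 := by rw [hTcard, hκ]
  have hlin : ∀ q, Set.InjOn (linLevel A d q a) (T : Set C) := fun q =>
    (linLevel_injOn A d q a).mono (by exact_mod_cast hTA)
  have hlin0 : ∀ q, ∀ x ∈ T, x ≠ d → s.ballotScore T (linLevel A d q a) x = 0 := fun q x hx hxd =>
    ballotScore_injOn_of_lt hmono hκ' (hlin q) hdT hx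
      (by rw [linLevel_fst]; exact one_le_linLevel hxd)
  have hlin1 : ∀ q, s.ballotScore T (linLevel A d q a) d = s.lin 3 0 := fun q => by
    rw [ballotScore_injOn_top (hlin q) hdT fun x _ => by simp, hTcard]
  have hbdc : ∀ x, s.ballotScore T (tieLevel b d c) x = s.ballotScore T (bottomLevel c) x := by
    have heq : ∀ x ∈ T, tieLevel b d c x = bottomLevel c x := by
      intro x hx
      rcases (hTmem x).1 hx with rfl | rfl | rfl
      · rw [(htie0 _ _ _).1, bottomLevel_of_ne hbc]
      · rw [htie1 _ _ _ hbc.symm hcd, bottomLevel_self]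
      · rw [(htie0 _ _ _).2, bottomLevel_of_ne hcd.symm]
    exact fun x => ballotScore_congr fun y hy z hz => by rw [heq y hy, heq z hz]
  have hcdb : ∀ x, s.ballotScore T (tieLevel c d b) x = s.ballotScore T (bottomLevel b) x := by
    have heq : ∀ x ∈ T, tieLevel c d b x = bottomLevel b x := by
      intro x hx
      rcases (hTmem x).1 hx with rfl | rfl | rfl
      · rw [htie1 _ _ _ hbc hbd, bottomLevel_self]
      · rw [(htie0 _ _ _).1, bottomLevel_of_ne hbc.symm]
      · rw [(htie0 _ _ _).2, bottomLevel_of_ne hbd.symm]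
    exact fun x => ballotScore_congr fun y hy z hz => by rw [heq y hy, heq z hz]
  have hv1 : tieLevel a b d b = 0 ∧ tieLevel a b d d = 1 ∧ tieLevel a b d c = 2 :=
    ⟨(htie0 _ _ _).2, htie1 _ _ _ had.symm hbd.symm, htie2 _ _ _ _ hac.symm hbc.symm hcd⟩
  have hv2 : tieLevel a c b c = 0 ∧ tieLevel a c b b = 1 ∧ tieLevel a c b d = 2 :=
    ⟨(htie0 _ _ _).2, htie1 _ _ _ hab.symm hbc, htie2 _ _ _ _ had.symm hcd.symm hbd.symm⟩
  have hi1 : Set.InjOn (tieLevel a b d) (T : Set C) := by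
    intro x hx y hy hxy
    rcases (hTmem x).1 hx with rfl | rfl | rfl <;> rcases (hTmem y).1 hy with rfl | rfl | rfl <;>
      first | rfl | omega
  have hi2 : Set.InjOn (tieLevel a c b) (T : Set C) := by
    intro x hx y hy hxy
    rcases (hTmem x).1 hx with rfl | rfl | rfl <;> rcases (hTmem y).1 hy with rfl | rfl | rfl <;>
      first | rfl | omega
  have htb : s.total T (L₁ ++ L₂) b = s.lin 3 0 + 4 * s.bot 3 := by
    rw [htot, hbdc, hcdb, hlin0 b b hbT hbd, hlin0 c b hbT hbd,
      ballotScore_injOn_top hi1 hbT fun x _ => by omega,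
      ballotScore_injOn_of_lt hmono hκ' hi2 hcT hbT (by omega),
      ballotScore_bot_of_ne hT2 hdT hbT hbd, ballotScore_bot_of_ne hT2 hcT hbT hbc,
      ballotScore_bot_self hT2 hbT, hTcard]
    ring
  have htc : s.total T (L₁ ++ L₂) c = s.lin 3 0 + 4 * s.bot 3 := by
    rw [htot, hbdc, hcdb, hlin0 b c hcT hcd, hlin0 c c hcT hcd,
      ballotScore_injOn_top hi2 hcT fun x _ => by omega,
      ballotScore_injOn_of_lt hmono hκ' hi1 hbT hcT (by omega),
      ballotScore_bot_of_ne hT2 hdT hcT hcd, ballotScore_bot_of_ne hT2 hbT hcT hbc.symm,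
      ballotScore_bot_self hT2 hcT, hTcard]
    ring
  have htd : s.total T (L₁ ++ L₂) d = 2 * s.lin 3 0 + 2 * s.bot 3 := by
    rw [htot, hbdc, hcdb, hlin1, hlin1,
      ballotScore_injOn_of_lt hmono hκ' hi2 hcT hdT (by omega),
      ballotScore_injOn_of_lt hmono hκ' hi1 hbT hdT (by omega),
      ballotScore_bot_of_ne hT2 hbT hdT hbd.symm, ballotScore_bot_of_ne hT2 hcT hdT hcd.symm,
      ballotScore_bot_self hT2 hdT, hTcard]
    ring
  -- after `a`, the alternative `b` can be eliminated, and then `c`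
  have hU : T.erase b = {c, d} := by
    ext x
    rw [Finset.mem_erase, hTmem, Finset.mem_insert, Finset.mem_singleton]
    grind
  have hUcard : #({c, d} : Finset C) = 2 := Finset.card_pair hcd
  -- Both have five approvals, so tie-breaking allows `c` to be eliminated.
  have hel1 : Elects s {c, d} (L₁ ++ L₂) d := by
    refine (elects_iff hUcard.ge).2 ⟨c, by simp, fun x hx => ?_, ?_⟩
    · rw [(happ _ hUcard).total_le_iff (by simp) hx]
      rcases Finset.mem_insert.1 hx with rfl | hx
      · exact le_rfl
      rw [Finset.mem_singleton.1 hx, hcount, hcount]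
      have hcU : c ∈ ({c, d} : Finset C) := by simp
      have hdU : d ∈ ({c, d} : Finset C) := by simp
      have hpair : ∀ g : C → ℕ, g d ≤ g c → ∀ x ∈ ({c, d} : Finset C), g d ≤ g x := by
        intro g hg x hx
        rcases Finset.mem_insert.1 hx with rfl | hx
        · exact hg
        · rw [Finset.mem_singleton.1 hx]
      have hlc : ∀ q, onTop {c, d} (linLevel A d q a) c = 0 := fun q =>
        onTop_linLevel_of_ne_fst hdU hcd
      have hld : ∀ q, onTop {c, d} (linLevel A d q a) d = 1 := fun q => onTop_linLevel_fst
      have h1 : onTop {c, d} (tieLevel a b d) c = 0 := onTop_eq_zero hdU (by omega)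
      have h2 : onTop {c, d} (tieLevel a b d) d = 1 := onTop_eq_one (hpair _ (by omega))
      have h3 : onTop {c, d} (tieLevel b d c) c = 0 := onTop_eq_zero hdU (by
        rw [(htie0 _ _ _).2, htie1 _ _ _ hbc.symm hcd]
        exact one_pos)
      have h4 : onTop {c, d} (tieLevel b d c) d = 1 :=
        onTop_eq_one fun x _ => by
          rw [(htie0 _ _ _).2]
          exact Nat.zero_le _
      have h5 : onTop {c, d} (tieLevel c d b) d = 1 :=
        onTop_eq_one fun x _ => by
          rw [(htie0 _ _ _).2]
          exact Nat.zero_le _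
      have h6 := onTop_le_one {c, d} (tieLevel c d b) c
      have h7 := onTop_le_one {c, d} (tieLevel a c b) c
      have h8 := onTop_le_one {c, d} (bottomLevel d) c
      rw [hlc, hlc, hld, hld, h1, h2, h3, h4, h5]
      omega
    · rw [Finset.erase_insert (by simpa using hcd)]
      exact elects_singleton s d _
  have hel2 : Elects s T (L₁ ++ L₂) d := by
    refine (elects_iff hT2).2 ⟨b, hbT, fun x hx => ?_, hU ▸ hel1⟩
    rcases (hTmem x).1 hx with rfl | rfl | rfl
    · exact le_rfl
    · rw [htb, htc]
    · rw [htb, htd]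
      linarith
  refine not_elects_of_majority hco ha (L₁ := L₁) (L₂ := L₂) (by simp [hL₁, hL₂]) (fun g hg => ?_)
    ((elects_iff hA2).2 ⟨a, ha, hla, hel2⟩)
  have hg' : g a = 0 ∧ 0 < g d := by
    simp only [hL₁, List.mem_cons, List.not_mem_nil, or_false] at hg
    rcases hg with rfl | rfl | rfl | rfl | rfl
    · exact ⟨(htie0 _ _ _).1, by omega⟩
    · exact ⟨(htie0 _ _ _).1, by omega⟩
    all_goals exact ⟨bottomLevel_of_ne had, by rw [bottomLevel_self]; exact one_pos⟩
  exact ⟨fun x _ => by omega, a, ha, by omega⟩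

end FourAlternatives

end Voting

/-! ### The induction on the number of alternatives -/

namespace Voting

variable {C : Type*}

open ScoringSystem

theorem exists_notMem_of_card_lt (hC : 4 ≤ ENat.card C) {A : Finset C} (hA : #A < 4) :
    ∃ x, x ∉ A := by
  by_contra h
  push Not at h
  have hu : (A : Set C) = Set.univ := Set.eq_univ_of_forall h
  rw [← Set.encard_univ, ← hu, Set.encard_coe_eq_coe_finsetCard] at hC
  exact absurd (by exact_mod_cast hC : 4 ≤ #A) (by omega)

theorem isApprovalOn_of_axioms (hC : 4 ≤ ENat.card C) {s : ScoringSystem} (hmono : s.IsMonotone)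
    (hcl : (eliminationRule C s).IndependentOfClones)
    (hco : (eliminationRule C s).RespectsCohesiveMajorities) (A : Finset C) (hA : 2 ≤ #A) :
    s.IsApprovalOn A := by
  classical
  induction hk : #A using Nat.strong_induction_on generalizing A with
  | _ k ih =>
    have happ : ∀ B : Finset C, 2 ≤ #B → #B < #A → s.IsApprovalOn B := fun B h2 hlt =>
      ih _ (hk ▸ hlt) B h2 rfl
    have hα := lin_zero_pos hmono hco hA
    have hle := bot_le_lin hco hcl hA
    rcases (by omega : #A = 2 ∨ #A = 3 ∨ 4 ≤ #A) with h | h | h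
    · refine isApprovalOn_of_bot_eq_lin hmono hco happ hA ?_ ?_
      · rw [h]
        exact lin_last two_pos
      · rw [h]
        -- For two alternatives, `[#A - 1, 1]` is the order type of a strict ballot.
        rfl
    · have hκ := lin_one_eq_zero hco hcl happ (by omega)
      refine isApprovalOn_of_bot_eq_lin hmono hco happ hA hκ (le_antisymm hle ?_)
      by_contra hlt
      have htwo := two_mul_bot_le_lin_of_lt hmono hco happ hA hκ (not_le.1 hlt)
      obtain ⟨a, b, c, hab, hac, hbc, hAeq⟩ := Finset.card_eq_three.1 h
      -- This is where the assumption of at least four alternatives enters: `d` lies outside the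
      -- three-element set `A`.
      obtain ⟨d, hd⟩ := exists_notMem_of_card_lt hC (by omega : #A < 4)
      rw [hAeq] at hd
      simp only [Finset.mem_insert, Finset.mem_singleton, not_or] at hd
      rw [h] at hκ hα htwo
      exact absurd (lin_three_lt_two_mul_bot hmono hco hcl (fun B hB => happ B (by omega) (by omega))
        hκ hα hab hac (Ne.symm hd.1) hbc (Ne.symm hd.2.1) (Ne.symm hd.2.2)) (not_lt.2 htwo)
    · have hκ := lin_one_eq_zero hco hcl happ (by omega)
      exact isApprovalOn_of_bot_eq_lin hmono hco happ hA hκ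
        (le_antisymm hle (lin_le_bot_of_four_le hmono hco hcl happ h hκ))

end Voting

theorem mainTheorem1 {C : Type*} (hC : 4 ≤ ENat.card C) (f : Voting.VotingRule C) :
    (f.IsEliminationScoringRule ∧ f.IndependentOfClones ∧ f.RespectsCohesiveMajorities) ↔
      f = Voting.approvalIRV C := by
  constructor
  · rintro ⟨⟨s, hmono, rfl⟩, hcl, hco⟩
    have h : Voting.eliminationWinners (C := C) s =
        Voting.eliminationWinners Voting.ScoringSystem.approval :=
      funext fun P => Voting.eliminationWinners_congr #P.cands
        (fun B hB _ => Voting.isApprovalOn_of_axioms hC hmono hcl hco B hB)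
        (fun B _ _ => Voting.ScoringSystem.isApprovalOn_approval B) P le_rfl
    simp only [Voting.approvalIRV, Voting.eliminationRule, h]
  · rintro rfl
    exact ⟨⟨_, Voting.ScoringSystem.isMonotone_approval, rfl⟩,
      Voting.approvalIRV_independentOfClones, Voting.approvalIRV_respectsCohesiveMajorities⟩
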